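/- Let $X,Z,\xi$ be independent random variables with values in arbitrary measurable spaces (for instance $X\in\mathbb R^{p_1}$, $Z\in\mathbb R^{p_2}$), and let $(Z',\xi')$ be a copy of $(Z,\xi)$ independent of $(X,Z,\xi)$. Let $f$ be a measurable real function, $Y=f(X,Z)$ and $Y^X=f(X,Z')$, and assume $\mathbb E(Y^2)<\infty$ and $\operatorname{Var}(Y)\neq 0$. For a square integrable random variable $W$ with $\operatorname{Var}(W)\ne0$, its Sobol index with respect to $X$ is $\operatorname{Var}(\mathbb E(W|X))/\operatorname{Var}(W)$; let $S^X$ be the index of $Y$. For every $N\ge 1$ let $\delta_N$ be a measurable real function of $(x,z,e)$, let $\widetilde f_N(x,z,e)=f(x,z)+\delta_N(x,z,e)$ be the metamodel, $\widetilde Y_N=\widetilde f_N(X,Z,\xi)$, and let $\widetilde S^X=\widetilde S^X(N)$ be the Sobol index of $\widetilde Y_N$ with respect to $X$ (which is well defined for all large $N$ under the assumptions below). Let $(X_i,Z_i,\xi_i,Z_i',\xi_i')_{i\ge1}$ be i.i.d. copies of $(X,Z,\xi,Z',\xi')$, and put $\widetilde Y_i=\widetilde f_N(X_i,Z_i,\xi_i)$,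 $\widetilde Y_i^X=\widetilde f_N(X_i,Z_i',\xi_i')$ for $1\le i\le N$ and $$\widetilde S^X_N=\frac{\frac1N\sum\widetilde Y_i\widetilde Y_i^X-\left(\frac1N\sum\widetilde Y_i\right)\left(\frac1N\sum\widetilde Y_i^X\right)}{\frac1N\sum\widetilde Y_i^2-\left(\frac1N\sum\widetilde Y_i\right)^2},\qquad \widetilde T^X_N=\frac{\frac1N\sum\widetilde Y_i\widetilde Y_i^X-\left(\frac1N\sum\frac{\widetilde Y_i+\widetilde Y_i^X}{2}\right)^2}{\frac1N\sum\frac{\widetilde Y_i^2+(\widetilde Y_i^X)^2}{2}-\left(\frac1N\sum\frac{\widetilde Y_i+\widetilde Y_i^X}{2}\right)^2},$$ all sums running over $i=1,\dots,N$ (a quotient with zero denominator is given the value $0$). Assume that $\delta_N(X,Z,\xi)\to c$ in $L^2$ as $N\to\infty$ for some constant $c\in\mathbb R$, and that there are $s>0$ and $C>0$ with $\mathbb E\left(|\widetilde Y_N|^{4+s}\right)<C$ for all $N\ge1$. Then, as $N\to\infty$, $$\sqrt N\left(\widetilde S^X_N-\widetilde S^X\right)\xrightarrow{\ \mathcal L\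 }\mathcal N(0,\sigma_S^2),\qquad \sqrt N\left(\widetilde T^X_N-\widetilde S^X\right)\xrightarrow{\ \mathcal L\ }\mathcal N(0,\sigma_T^2),$$ where $$\sigma_S^2=\frac{\operatorname{Var}\left((Y-\mathbb E Y)\left[(Y^X-\mathbb E Y)-S^X(Y-\mathbb E Y)\right]\right)}{(\operatorname{Var}Y)^2},$$ $$\sigma_T^2=\frac{\operatorname{Var}\left((Y-\mathbb E Y)(Y^X-\mathbb E Y)-\frac{S^X}{2}\left((Y-\mathbb E Y)^2+(Y^X-\mathbb E Y)^2\right)\right)}{(\operatorname{Var}Y)^2}$$ and $\mathcal N(0,0)$ denotes the Dirac mass at $0$. -/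

import Mathlib

open MeasureTheory ProbabilityTheory Filter Topology

noncomputable section

namespace SobolPickFreeze

/-- The (closed) Sobol index `Var(E(Y | X)) / Var(Y)` of the output `Y` with respect to the
input `X`. -/
def sobolIndex {Ω 𝒳 : Type*} [MeasurableSpace Ω] [m𝒳 : MeasurableSpace 𝒳] (P : Measure Ω)
    (X : Ω → 𝒳) (Y : Ω → ℝ) : ℝ :=
  variance (P[Y | m𝒳.comap X]) P / variance Y P

/-- Empirical mean `(r₀ + ⋯ + r_{N-1}) / N` of the first `N` terms of a sequence. -/
def empMean (N : ℕ) (r : ℕ → ℝ) : ℝ :=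
  (1 / (N : ℝ)) * ∑ i ∈ Finset.range N, r i

/-- The first estimator, computed from the first `N` pairs `(y i, y' i)`. -/
def estimS (N : ℕ) (y y' : ℕ → ℝ) : ℝ :=
  (empMean N (fun i => y i * y' i) - empMean N y * empMean N y') /
    (empMean N (fun i => y i ^ 2) - empMean N y ^ 2)

/-- The second (symmetrized) estimator, computed from the first `N` pairs `(y i, y' i)`. -/
def estimT (N : ℕ) (y y' : ℕ → ℝ) : ℝ :=
  (empMean N (fun i => y i * y' i) - empMean N (fun i => (y i + y' i) / 2) ^ 2) /
    (empMean N (fun i => (y i ^ 2 + y' i ^ 2) / 2) -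
      empMean N (fun i => (y i + y' i) / 2) ^ 2)

/-- `σ_S²`, for an output `Y`, its pick-freeze copy `YX` and a Sobol index `S`. -/
def sigmaSqS {Ω : Type*} [MeasurableSpace Ω] (P : Measure Ω) (Y YX : Ω → ℝ) (S : ℝ) : ℝ :=
  variance (fun ω => (Y ω - ∫ ω', Y ω' ∂P) *
      ((YX ω - ∫ ω', Y ω' ∂P) - S * (Y ω - ∫ ω', Y ω' ∂P))) P / variance Y P ^ 2

/-- `σ_T²`, for an output `Y`, its pick-freeze copy `YX` and a Sobol index `S`. -/
def sigmaSqT {Ω : Type*} [MeasurableSpace Ω] (P : Measure Ω) (Y YX : Ω → ℝ) (S : ℝ) : ℝ :=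
  variance (fun ω => (Y ω - ∫ ω', Y ω' ∂P) * (YX ω - ∫ ω', Y ω' ∂P) -
      S / 2 * ((Y ω - ∫ ω', Y ω' ∂P) ^ 2 + (YX ω - ∫ ω', Y ω' ∂P) ^ 2)) P / variance Y P ^ 2

/-- `X`, `Z`, `ξ`, `Z'`, `ξ'` are mutually independent random variables, and `Z'`, `ξ'` are copies
of `Z`, `ξ`: their joint law is `law X ⊗ law Z ⊗ law ξ ⊗ law Z ⊗ law ξ`. -/
structure IsPickFreezeInput {Ω 𝒳 𝒵 E : Type*} [MeasurableSpace Ω] [MeasurableSpace 𝒳]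
    [MeasurableSpace 𝒵] [MeasurableSpace E] (P : Measure Ω)
    (X : Ω → 𝒳) (Z : Ω → 𝒵) (ξ : Ω → E) (Z' : Ω → 𝒵) (ξ' : Ω → E) : Prop where
  measurable_X : Measurable X
  measurable_Z : Measurable Z
  measurable_ξ : Measurable ξ
  measurable_Z' : Measurable Z'
  measurable_ξ' : Measurable ξ'
  map_eq : P.map (fun ω => (X ω, Z ω, ξ ω, Z' ω, ξ' ω)) =
    (P.map X).prod ((P.map Z).prod ((P.map ξ).prod ((P.map Z).prod (P.map ξ))))

/-- `W 0, W 1, …` are independent and each has the law of `V`. -/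
structure IsIIDSample {Ω Ω₀ 𝒲 : Type*} [MeasurableSpace Ω] [MeasurableSpace Ω₀]
    [MeasurableSpace 𝒲] (μ : Measure Ω) (W : ℕ → Ω → 𝒲) (P : Measure Ω₀) (V : Ω₀ → 𝒲) :
    Prop where
  measurable : ∀ i, Measurable (W i)
  indep : iIndepFun W μ
  identDistrib : ∀ i, IdentDistrib (W i) V μ P

end SobolPickFreeze

end

/-! Both estimators are unchanged when one constant is subtracted from all outputs, so everything
may be centered at the mean of the metamodel; the limit `c` of `δ N` then disappears. After
centering, numerator and denominator are empirical means of quadratic functions `n N`, `d N` of one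
sample point, minus products of two centered empirical means. By the pick-freeze identity
(`variance_condExp_eq_integral_mul`) the index of the metamodel is exactly `S N = ∫ n N / ∫ d N`.

Multiplying the normalized error by its denominator gives `√N` times the empirical mean of `n N - S
N * d N`, plus `√N` times products of centered means. Those products are of order `N^(-1/2)` in
`L¹`. The function `n N - S N * d N` has mean zero and converges in `L²` to a fixed `u = n₀ - S₀ *
d₀`. A normalized mean of centered i.i.d. terms has the `L²` norm of a single term, so replacing the
former by `u` costs `o(1)`. The classical central limit theorem for `u` therefore suffices, with no
triangular-array version, and Slutsky's theorem divides by the limit of the denominator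
(`tendstoInDistribution_ratio`).

`L²` convergence of the quadratic functions requires `L⁴` convergence of the metamodels. It follows
by interpolating between the assumed `L²` convergence and the bound in `L^(4 + s)`
(`tendsto_eLpNorm_four`). -/

namespace SobolPickFreeze

/-! ### Empirical means and their exact `L²` size -/

section EmpiricalMean

variable {Ω 𝒲 : Type*} [MeasurableSpace Ω] [MeasurableSpace 𝒲] {μ : Measure Ω} {ν : Measure 𝒲}
  {W : ℕ → Ω → 𝒲}

lemma measurable_empMean {r : ℕ → Ω → ℝ} (hr : ∀ i, Measurable (r i)) (N : ℕ) :
    Measurable (fun ω => empMean N (fun i => r i ω)) := by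
  unfold empMean
  exact (Finset.measurable_fun_sum _ fun i _ => hr i).const_mul _

lemma empMean_add (N : ℕ) (r t : ℕ → ℝ) :
    empMean N (fun i => r i + t i) = empMean N r + empMean N t := by
  simp only [empMean, Finset.sum_add_distrib, mul_add]

lemma empMean_sub (N : ℕ) (r t : ℕ → ℝ) :
    empMean N (fun i => r i - t i) = empMean N r - empMean N t := by
  simp only [empMean, Finset.sum_sub_distrib, mul_sub]

lemma empMean_const_mul (N : ℕ) (c : ℝ) (r : ℕ → ℝ) :
    empMean N (fun i => c * r i) = c * empMean N r := by
  simp only [empMean, ← Finset.mul_sum]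
  ring

lemma empMean_const {N : ℕ} (hN : N ≠ 0) (c : ℝ) : empMean N (fun _ => c) = c := by
  have : (N : ℝ) ≠ 0 := by exact_mod_cast hN
  simp only [empMean, Finset.sum_const, Finset.card_range, nsmul_eq_mul]
  field_simp

lemma eLpNorm_two_sq_eq_ofReal_variance [IsFiniteMeasure μ] {X : Ω → ℝ} (hX : MemLp X 2 μ)
    (h0 : ∫ ω, X ω ∂μ = 0) : eLpNorm X 2 μ ^ 2 = ENNReal.ofReal (variance X μ) := by
  rw [ofReal_variance hX, evariance, eLpNorm_eq_lintegral_rpow_enorm_toReal (by simp) (by simp)]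
  rw [← ENNReal.rpow_natCast, ← ENNReal.rpow_mul]
  simp [h0]

lemma integral_comp_of_measurePreserving {T : Ω → 𝒲} (hT : MeasurePreserving T μ ν)
    {g : 𝒲 → ℝ} (hg : Measurable g) : ∫ ω, g (T ω) ∂μ = ∫ w, g w ∂ν := by
  rw [← hT.map_eq, integral_map hT.aemeasurable hg.aestronglyMeasurable]

lemma variance_comp_of_measurePreserving {T : Ω → 𝒲} (hT : MeasurePreserving T μ ν)
    {g : 𝒲 → ℝ} (hg : Measurable g) : variance (fun ω => g (T ω)) μ = variance g ν := by
  rw [← hT.map_eq, variance_map hg.aemeasurable hT.aemeasurable]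
  rfl

lemma eLpNorm_comp_of_measurePreserving {T : Ω → 𝒲} (hT : MeasurePreserving T μ ν)
    {g : 𝒲 → ℝ} (hg : Measurable g) (p : ENNReal) :
    eLpNorm (fun ω => g (T ω)) p μ = eLpNorm g p ν :=
  eLpNorm_comp_measurePreserving hg.aestronglyMeasurable hT

variable [IsProbabilityMeasure μ] [IsProbabilityMeasure ν]

/-- The normalized empirical mean of a centered square integrable function has the `L²` norm of
that function. -/
lemma eLpNorm_sqrt_mul_empMean (hW : ∀ i, MeasurePreserving (W i) μ ν) (hind : iIndepFun W μ)
    {g : 𝒲 → ℝ} (hgm : Measurable g) (hg : MemLp g 2 ν) (h0 : ∫ w, g w ∂ν = 0) {N : ℕ}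
    (hN : N ≠ 0) :
    eLpNorm (fun ω => √N * empMean N (fun i => g (W i ω))) 2 μ = eLpNorm g 2 ν := by
  have hN' : (0 : ℝ) < N := by exact_mod_cast Nat.pos_of_ne_zero hN
  have hL : ∀ i, MemLp (fun ω => g (W i ω)) 2 μ := fun i => hg.comp_measurePreserving (hW i)
  have hsum : MemLp (fun ω => √N * empMean N (fun i => g (W i ω))) 2 μ := by
    unfold empMean
    exact ((memLp_finsetSum _ fun i _ => hL i).const_mul _).const_mul _
  have hint : ∫ ω, √N * empMean N (fun i => g (W i ω)) ∂μ = 0 := by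
    unfold empMean
    rw [integral_const_mul, integral_const_mul,
      integral_finsetSum _ fun i _ => (hL i).integrable (by norm_num)]
    simp [integral_comp_of_measurePreserving (hW _) hgm, h0]
  -- The factors cancel: `(√N)² * (1 / N)² * N = 1`, the last `N` being the number of independent
  -- summands.
  have hvar : variance (fun ω => √N * empMean N (fun i => g (W i ω))) μ = variance g ν := by
    unfold empMean
    rw [variance_const_mul, variance_const_mul]
    have h1 := IndepFun.variance_sum (μ := μ) (X := fun i ω => g (W i ω))
      (s := Finset.range N) (fun i _ => hL i)
      (fun i _ j _ hij => (hind.indepFun hij).comp hgm hgm)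
    have h2 : (∑ i ∈ Finset.range N, fun ω => g (W i ω)) =
        fun ω => ∑ i ∈ Finset.range N, g (W i ω) := by
      ext ω; simp
    rw [h2] at h1
    rw [h1]
    simp only [variance_comp_of_measurePreserving (hW _) hgm, Finset.sum_const, Finset.card_range,
      nsmul_eq_mul]
    rw [Real.sq_sqrt hN'.le]
    field_simp
  have := eLpNorm_two_sq_eq_ofReal_variance hsum hint
  rw [hvar, ← eLpNorm_two_sq_eq_ofReal_variance hg h0] at this
  simp only [← ENNReal.rpow_natCast] at this
  exact ENNReal.rpow_left_injective (by norm_num) this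

/-- Products of two centered empirical means are of order `1 / N` in `L¹`. -/
lemma eLpNorm_sqrt_mul_empMean_mul_empMean_le (hW : ∀ i, MeasurePreserving (W i) μ ν)
    (hind : iIndepFun W μ) {p q : 𝒲 → ℝ} (hpm : Measurable p) (hqm : Measurable q)
    (hp : MemLp p 2 ν) (hq : MemLp q 2 ν) (hp0 : ∫ w, p w ∂ν = 0) (hq0 : ∫ w, q w ∂ν = 0) {N : ℕ}
    (hN : N ≠ 0) :
    eLpNorm (fun ω => √N * (empMean N (fun i => p (W i ω)) * empMean N (fun i => q (W i ω)))) 1 μ ≤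
      ‖(√(N : ℝ))⁻¹‖ₑ * (eLpNorm p 2 ν * eLpNorm q 2 ν) := by
  have hN' : (0 : ℝ) < √N := Real.sqrt_pos.2 (by exact_mod_cast Nat.pos_of_ne_zero hN)
  have hmeas : ∀ g : 𝒲 → ℝ, Measurable g →
      Measurable (fun ω => √N * empMean N (fun i => g (W i ω))) := fun g hg =>
    (measurable_empMean (r := fun i ω => g (W i ω)) (fun i => hg.comp (hW i).measurable) N).const_mul _
  -- Each mean gets its own factor `√N`, which leaves `1 / √N` in front; Cauchy–Schwarz then
  -- separates the two normalized means.
  have h : (fun ω => √N * (empMean N (fun i => p (W i ω)) * empMean N (fun i => q (W i ω)))) =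
      (√(N : ℝ))⁻¹ • ((fun ω => √N * empMean N (fun i => p (W i ω))) •
        (fun ω => √N * empMean N (fun i => q (W i ω)))) := by
    ext ω
    simp only [Pi.smul_apply, Pi.mul_apply, smul_eq_mul]
    field_simp
  rw [h, eLpNorm_const_smul, ← eLpNorm_sqrt_mul_empMean hW hind hpm hp hp0 hN,
    ← eLpNorm_sqrt_mul_empMean hW hind hqm hq hq0 hN]
  gcongr
  exact eLpNorm_smul_le_mul_eLpNorm (hmeas q hqm).aestronglyMeasurable
    (hmeas p hpm).aestronglyMeasurable

end EmpiricalMean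

/-! ### Convergence in measure of inverses, and Slutsky's theorem -/

section Slutsky

variable {Ω : Type*} [MeasurableSpace Ω] {μ : Measure Ω} [IsProbabilityMeasure μ]

lemma half_abs_le_abs_of_abs_sub_lt {b v : ℝ} (h : |b - v| < |v| / 2) : |v| / 2 ≤ |b| := by
  have := abs_sub_abs_le_abs_sub v b
  rw [abs_sub_comm] at this
  linarith

-- A union bound: for large `N`, a deviation of `C` forces a fixed deviation of `A` or of `B`, so
-- only a pointwise implication has to be checked.
omit [IsProbabilityMeasure μ] in
lemma tendstoInMeasure_of_norm_subset {A B C : ℕ → Ω → ℝ} {a b c : Ω → ℝ}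
    (hA : TendstoInMeasure μ A atTop a) (hB : TendstoInMeasure μ B atTop b)
    (h : ∀ ε > 0, ∃ α > 0, ∃ β > 0, ∀ᶠ N in atTop, ∀ ω, ε ≤ ‖C N ω - c ω‖ →
      α ≤ ‖A N ω - a ω‖ ∨ β ≤ ‖B N ω - b ω‖) :
    TendstoInMeasure μ C atTop c := by
  rw [tendstoInMeasure_iff_norm] at *
  intro ε hε
  obtain ⟨α, hα, β, hβ, hsub⟩ := h ε hε
  refine tendsto_of_tendsto_of_tendsto_of_le_of_le' tendsto_const_nhds
    (by simpa using (hA α hα).add (hB β hβ)) (Eventually.of_forall fun _ => zero_le) ?_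
  filter_upwards [hsub] with N hN
  exact (measure_mono fun ω hω => hN ω hω).trans (measure_union_le _ _)

omit [IsProbabilityMeasure μ] in
lemma tendstoInMeasure_inv {B : ℕ → Ω → ℝ} {v : ℝ} (hv : v ≠ 0)
    (hB : TendstoInMeasure μ B atTop (fun _ => v)) :
    TendstoInMeasure μ (fun N ω => (B N ω)⁻¹) atTop (fun _ => v⁻¹) := by
  have hv' : 0 < |v| := abs_pos.2 hv
  -- Both alternatives concern `B`: the threshold `|v| / 2` keeps `|B|` above `|v| / 2`, and then
  -- the second one bounds `|B - v| / (|B| * |v|)` by `ε`.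
  refine tendstoInMeasure_of_norm_subset hB hB fun ε hε =>
    ⟨|v| / 2, by positivity, ε * (|v| / 2 * |v|), by positivity, Eventually.of_forall fun N ω h => ?_⟩
  by_contra! hcon
  simp only [Real.norm_eq_abs] at *
  have hb := half_abs_le_abs_of_abs_sub_lt hcon.1
  have hb0 : 0 < |B N ω| := by linarith
  have : |(B N ω)⁻¹ - v⁻¹| = |B N ω - v| / (|B N ω| * |v|) := by
    rw [inv_sub_inv (abs_pos.1 hb0) hv, abs_div, abs_mul, abs_sub_comm]
  rw [this, le_div_iff₀ (by positivity)] at h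
  have : ε * (|v| / 2 * |v|) ≤ ε * (|B N ω| * |v|) := by gcongr
  linarith

/-- **Slutsky's theorem** for quotients: if `Q B = M + H` wherever `B ≠ 0`, where `M` converges in
distribution to `Z`, `B` in probability to `v ≠ 0` and `H` in probability to `0`, then `Q` converges
in distribution to `Z / v`. -/
lemma tendstoInDistribution_of_mul_eq_add {Ω' : Type*} [MeasurableSpace Ω'] {P : Measure Ω'}
    [IsProbabilityMeasure P] {Z : Ω' → ℝ} {Q M B H : ℕ → Ω → ℝ} {v : ℝ} (hv : v ≠ 0)
    (hM : TendstoInDistribution M atTop Z (fun _ => μ) P)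
    (hB : TendstoInMeasure μ B atTop (fun _ => v)) (hH : TendstoInMeasure μ H atTop 0)
    (hQm : ∀ N, Measurable (Q N)) (hBm : ∀ N, Measurable (B N))
    (hQ : ∀ᶠ N in atTop, ∀ ω, B N ω ≠ 0 → Q N ω * B N ω = M N ω + H N ω) :
    TendstoInDistribution Q atTop (fun x => Z x * v⁻¹) (fun _ => μ) P := by
  have hv' : 0 < |v| := abs_pos.2 hv
  have h1 := hM.continuous_comp_prodMk_of_tendstoInMeasure_const
    (g := fun x : ℝ × ℝ => x.1 * x.2) (by fun_prop) (tendstoInMeasure_inv hv hB)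
    (fun N => (hBm N).inv.aemeasurable)
  refine tendstoInDistribution_of_tendstoInMeasure_sub Q _ h1 ?_ fun N => (hQm N).aemeasurable
  -- Where `|B| ≥ |v| / 2` the error is `H / B`. The event `B = 0`, where a quotient takes its
  -- default value, lies in the deviation event of `B`.
  refine tendstoInMeasure_of_norm_subset hH hB fun ε hε =>
    ⟨ε * (|v| / 2), by positivity, |v| / 2, by positivity, ?_⟩
  filter_upwards [hQ] with N hN ω h
  by_contra! hcon
  simp only [Real.norm_eq_abs, Pi.sub_apply, Pi.zero_apply, sub_zero] at *
  have hb := half_abs_le_abs_of_abs_sub_lt hcon.2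
  have hb0 : 0 < |B N ω| := by linarith
  have hb1 : B N ω ≠ 0 := abs_pos.1 hb0
  have : Q N ω - M N ω * (B N ω)⁻¹ = H N ω / B N ω := by
    have := hN ω hb1
    field_simp
    linarith
  rw [this, abs_div, le_div_iff₀ hb0] at h
  have : ε * (|v| / 2) ≤ ε * |B N ω| := by gcongr
  linarith [hcon.1]

end Slutsky

/-! ### Central limit theorem for ratios with functions depending on `N` -/

section RatioCLT

variable {Ω 𝒲 : Type*} [MeasurableSpace Ω] [MeasurableSpace 𝒲] {μ : Measure Ω} {ν : Measure 𝒲}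
  {W : ℕ → Ω → 𝒲}

/-- Sequences of measurable functions that are eventually centered and bounded in `L²`. -/
def CenteredL2Bounded (ν : Measure 𝒲) (p : ℕ → 𝒲 → ℝ) : Prop :=
  (∀ N, Measurable (p N)) ∧ ∃ K : ENNReal, K ≠ ⊤ ∧
    ∀ᶠ N in atTop, eLpNorm (p N) 2 ν ≤ K ∧ ∫ w, p N w ∂ν = 0

/-- Norms tending to `0` are eventually finite; finitely many early terms may lie outside `L^p`. -/
lemma memLp_of_tendsto_eLpNorm_sub {p : ENNReal} {g : ℕ → 𝒲 → ℝ} {g₀ : 𝒲 → ℝ}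
    (hg : ∀ N, Measurable (g N)) (hg₀ : MemLp g₀ p ν)
    (h : Tendsto (fun N => eLpNorm (fun w => g N w - g₀ w) p ν) atTop (𝓝 0)) :
    ∀ᶠ N in atTop, MemLp (g N) p ν := by
  filter_upwards [h.eventually_lt_const (ENNReal.zero_lt_top)] with N hN
  have : MemLp (fun w => g N w - g₀ w) p ν :=
    ⟨(hg N).aestronglyMeasurable.sub hg₀.1, hN⟩
  convert this.add hg₀ using 1
  ext w
  simp

variable [IsProbabilityMeasure ν]

lemma tendsto_integral_of_tendsto_eLpNorm_sub {p : ENNReal} (hp : 1 ≤ p) {g : ℕ → 𝒲 → ℝ}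
    {g₀ : 𝒲 → ℝ} (hg : ∀ N, Measurable (g N)) (hg₀ : MemLp g₀ p ν)
    (h : Tendsto (fun N => eLpNorm (fun w => g N w - g₀ w) p ν) atTop (𝓝 0)) :
    Tendsto (fun N => ∫ w, g N w ∂ν) atTop (𝓝 (∫ w, g₀ w ∂ν)) := by
  refine tendsto_integral_of_L1' g₀ hg₀.1 ?_ ?_
  · filter_upwards [memLp_of_tendsto_eLpNorm_sub hg hg₀ h] with N hN using hN.integrable hp
  · refine tendsto_of_tendsto_of_tendsto_of_le_of_le tendsto_const_nhds h
      (fun _ => zero_le) fun N => ?_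
    exact eLpNorm_le_eLpNorm_of_exponent_le hp ((hg N).aestronglyMeasurable.sub hg₀.1)

variable [IsProbabilityMeasure μ]

lemma tendsto_eLpNorm_sqrt_mul_empMean_mul_empMean (hW : ∀ i, MeasurePreserving (W i) μ ν)
    (hind : iIndepFun W μ) {p q : ℕ → 𝒲 → ℝ} (hp : CenteredL2Bounded ν p)
    (hq : CenteredL2Bounded ν q) :
    Tendsto (fun N : ℕ => eLpNorm (fun ω => √N * (empMean N (fun i => p N (W i ω)) *
      empMean N (fun i => q N (W i ω)))) 1 μ) atTop (𝓝 0) := by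
  obtain ⟨hpm, K, hK, hpK⟩ := hp
  obtain ⟨hqm, L, hL, hqL⟩ := hq
  have h0 : Tendsto (fun N : ℕ => ‖(√(N : ℝ))⁻¹‖ₑ * (K * L)) atTop (𝓝 0) := by
    have h1 : Tendsto (fun N : ℕ => ‖(√(N : ℝ))⁻¹‖ₑ) atTop (𝓝 0) := by
      have := ((Real.tendsto_sqrt_atTop.comp tendsto_natCast_atTop_atTop).inv_tendsto_atTop
        (𝕜 := ℝ)).enorm
      simpa using this
    simpa using ENNReal.Tendsto.mul_const h1 (Or.inr (ENNReal.mul_ne_top hK hL))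
  refine tendsto_of_tendsto_of_tendsto_of_le_of_le' tendsto_const_nhds h0
    (Eventually.of_forall fun _ => zero_le) ?_
  filter_upwards [hpK, hqL, eventually_ne_atTop 0] with N h1 h2 hN
  refine (eLpNorm_sqrt_mul_empMean_mul_empMean_le hW hind (hpm N) (hqm N)
    ⟨(hpm N).aestronglyMeasurable, h1.1.trans_lt hK.lt_top⟩
    ⟨(hqm N).aestronglyMeasurable, h2.1.trans_lt hL.lt_top⟩ h1.2 h2.2 hN).trans ?_
  gcongr
  exacts [h1.1, h2.1]

omit [IsProbabilityMeasure μ] in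
lemma tendsto_eLpNorm_one_add {f g : ℕ → Ω → ℝ} (hf : ∀ N, Measurable (f N))
    (hg : ∀ N, Measurable (g N)) (hf0 : Tendsto (fun N => eLpNorm (f N) 1 μ) atTop (𝓝 0))
    (hg0 : Tendsto (fun N => eLpNorm (g N) 1 μ) atTop (𝓝 0)) :
    Tendsto (fun N => eLpNorm (f N + g N) 1 μ) atTop (𝓝 0) :=
  tendsto_of_tendsto_of_tendsto_of_le_of_le tendsto_const_nhds (by simpa using hf0.add hg0)
    (fun _ => zero_le) fun N => eLpNorm_add_le (hf N).aestronglyMeasurable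
      (hg N).aestronglyMeasurable le_rfl

omit [IsProbabilityMeasure μ] in
lemma tendsto_eLpNorm_one_mul_of_bounded {f : ℕ → Ω → ℝ} {c : ℕ → ℝ} {b : ℝ}
    (hc : Tendsto c atTop (𝓝 b)) (hf0 : Tendsto (fun N => eLpNorm (f N) 1 μ) atTop (𝓝 0)) :
    Tendsto (fun N => eLpNorm (fun ω => c N * f N ω) 1 μ) atTop (𝓝 0) := by
  have h : ∀ N, eLpNorm (fun ω => c N * f N ω) 1 μ = ‖c N‖ₑ * eLpNorm (f N) 1 μ := fun N =>
    eLpNorm_const_smul (c N) (f N) 1 μ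
  simp only [h]
  simpa using ENNReal.Tendsto.mul hc.enorm (Or.inr ENNReal.zero_ne_top) hf0
    (Or.inr (by simp))

omit [IsProbabilityMeasure ν] [IsProbabilityMeasure μ] in
lemma measurable_empMean_comp (hW : ∀ i, MeasurePreserving (W i) μ ν) {g : 𝒲 → ℝ}
    (hg : Measurable g) (N : ℕ) : Measurable (fun ω => empMean N (fun i => g (W i ω))) :=
  measurable_empMean (r := fun i ω => g (W i ω)) (fun i => hg.comp (hW i).measurable) N

/-- Normalized empirical means of centered functions tending to `0` in `L²` vanish in `L¹`. -/
lemma tendsto_eLpNorm_sqrt_mul_empMean (hW : ∀ i, MeasurePreserving (W i) μ ν)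
    (hind : iIndepFun W μ) {g : ℕ → 𝒲 → ℝ} (hgm : ∀ N, Measurable (g N))
    (h0 : ∀ᶠ N in atTop, ∫ w, g N w ∂ν = 0)
    (hg : Tendsto (fun N => eLpNorm (g N) 2 ν) atTop (𝓝 0)) :
    Tendsto (fun N : ℕ => eLpNorm (fun ω => √N * empMean N (fun i => g N (W i ω))) 1 μ)
      atTop (𝓝 0) := by
  refine tendsto_of_tendsto_of_tendsto_of_le_of_le' tendsto_const_nhds hg
    (Eventually.of_forall fun _ => zero_le) ?_
  filter_upwards [h0, eventually_ne_atTop 0, hg.eventually_lt_const ENNReal.zero_lt_top]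
    with N h1 hN h2
  rw [← eLpNorm_sqrt_mul_empMean hW hind (hgm N) ⟨(hgm N).aestronglyMeasurable, h2⟩ h1 hN]
  exact eLpNorm_le_eLpNorm_of_exponent_le (by norm_num)
    ((measurable_empMean_comp hW (hgm N) N).const_mul _).aestronglyMeasurable

/-- The weak law of large numbers for a triangular array, in `L¹`. -/
lemma tendsto_eLpNorm_empMean_sub (hW : ∀ i, MeasurePreserving (W i) μ ν)
    (hind : iIndepFun W μ) {d : ℕ → 𝒲 → ℝ} {d₀ : 𝒲 → ℝ} (hdm : ∀ N, Measurable (d N))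
    (hd₀m : Measurable d₀) (hd₀ : MemLp d₀ 2 ν)
    (hd : Tendsto (fun N => eLpNorm (fun w => d N w - d₀ w) 2 ν) atTop (𝓝 0)) :
    Tendsto (fun N : ℕ => eLpNorm (fun ω => empMean N (fun i => d N (W i ω)) - ∫ w, d₀ w ∂ν) 1 μ)
      atTop (𝓝 0) := by
  have hE := tendsto_integral_of_tendsto_eLpNorm_sub (by norm_num) hdm hd₀ hd
  have hL2 := memLp_of_tendsto_eLpNorm_sub hdm hd₀ hd
  set v := ∫ w, d₀ w ∂ν with hv
  -- The error splits into the means of the centered difference `g N` and of the centered limit `k`,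
  -- plus the constant `∫ d N - v`.
  set g : ℕ → 𝒲 → ℝ := fun N w => (d N w - d₀ w) - (∫ w, d N w ∂ν - v) with hgdef
  have hgm : ∀ N, Measurable (g N) := fun N => ((hdm N).sub hd₀m).sub_const _
  have hg0 : ∀ᶠ N in atTop, ∫ w, g N w ∂ν = 0 := by
    filter_upwards [hL2] with N hN
    have h1 := hN.integrable (by norm_num : (1 : ENNReal) ≤ 2)
    have h2 := hd₀.integrable (by norm_num : (1 : ENNReal) ≤ 2)
    simp only [hgdef]
    have h3 : Integrable (fun w => d N w - d₀ w) ν := h1.sub h2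
    rw [integral_sub h3 (integrable_const _), integral_sub h1 h2]
    simp [hv]
  have hg : Tendsto (fun N => eLpNorm (g N) 2 ν) atTop (𝓝 0) := by
    have hc : Tendsto (fun N => ‖∫ w, d N w ∂ν - v‖ₑ) atTop (𝓝 0) := by
      simpa using (hE.sub_const v).enorm
    refine tendsto_of_tendsto_of_tendsto_of_le_of_le tendsto_const_nhds
      (by simpa using hd.add hc) (fun _ => zero_le) fun N => ?_
    refine (eLpNorm_sub_le ((hdm N).sub hd₀m).aestronglyMeasurable
      aestronglyMeasurable_const (by norm_num)).trans ?_
    rw [eLpNorm_const _ (by norm_num) (NeZero.ne ν)]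
    simp only [measure_univ, ENNReal.one_rpow, mul_one]
    rfl
  have h1 := tendsto_eLpNorm_sqrt_mul_empMean hW hind hgm hg0 hg
  have h1' : Tendsto (fun N : ℕ => eLpNorm (fun ω => empMean N (fun i => g N (W i ω))) 1 μ)
      atTop (𝓝 0) := by
    refine tendsto_of_tendsto_of_tendsto_of_le_of_le' tendsto_const_nhds h1
      (Eventually.of_forall fun _ => zero_le) ?_
    filter_upwards [eventually_ge_atTop 1] with N hN
    refine eLpNorm_mono fun ω => ?_
    rw [norm_mul]
    refine le_mul_of_one_le_left (norm_nonneg _) ?_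
    rw [Real.norm_of_nonneg (Real.sqrt_nonneg _)]
    exact Real.one_le_sqrt.2 (by exact_mod_cast hN)
  -- the law of large numbers for the limit function
  set k : 𝒲 → ℝ := fun w => d₀ w - v with hkdef
  have hkm : Measurable k := hd₀m.sub_const _
  have hk : MemLp k 2 ν := hd₀.sub (memLp_const _)
  have hk0 : ∫ w, k w ∂ν = 0 := by
    simp only [hkdef]
    rw [integral_sub (hd₀.integrable (by norm_num)) (integrable_const _)]
    simp [hv]
  have h2 : Tendsto (fun N : ℕ => eLpNorm (fun ω => empMean N (fun i => k (W i ω))) 1 μ)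
      atTop (𝓝 0) := by
    have h0 : Tendsto (fun N : ℕ => ‖(√(N : ℝ))⁻¹‖ₑ * eLpNorm k 2 ν) atTop (𝓝 0) := by
      have h1 : Tendsto (fun N : ℕ => ‖(√(N : ℝ))⁻¹‖ₑ) atTop (𝓝 0) := by
        have := ((Real.tendsto_sqrt_atTop.comp tendsto_natCast_atTop_atTop).inv_tendsto_atTop
          (𝕜 := ℝ)).enorm
        simpa using this
      simpa using ENNReal.Tendsto.mul_const h1 (Or.inr hk.2.ne)
    refine tendsto_of_tendsto_of_tendsto_of_le_of_le' tendsto_const_nhds h0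
      (Eventually.of_forall fun _ => zero_le) ?_
    filter_upwards [eventually_ne_atTop 0] with N hN
    have hN' : (0 : ℝ) < √N := Real.sqrt_pos.2 (by exact_mod_cast Nat.pos_of_ne_zero hN)
    have h3 : (fun ω => empMean N (fun i => k (W i ω))) =
        (√(N : ℝ))⁻¹ • (fun ω => √N * empMean N (fun i => k (W i ω))) := by
      ext ω
      simp only [Pi.smul_apply, smul_eq_mul]
      field_simp
    rw [h3, eLpNorm_const_smul, ← eLpNorm_sqrt_mul_empMean hW hind hkm hk hk0 hN]
    gcongr
    exact eLpNorm_le_eLpNorm_of_exponent_le (by norm_num)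
      ((measurable_empMean_comp hW hkm N).const_mul _).aestronglyMeasurable
  have h3 : Tendsto (fun N : ℕ => eLpNorm (fun _ : Ω => ∫ w, d N w ∂ν - v) 1 μ) atTop (𝓝 0) := by
    have h4 : ∀ N : ℕ, eLpNorm (fun _ : Ω => ∫ w, d N w ∂ν - v) 1 μ = ‖∫ w, d N w ∂ν - v‖ₑ := by
      intro N
      rw [eLpNorm_const _ (by norm_num) (NeZero.ne μ)]
      simp
    simp only [h4]
    simpa using (hE.sub_const v).enorm
  have h5 := tendsto_eLpNorm_one_add (fun N => (measurable_empMean_comp hW (hgm N) N).add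
    (measurable_empMean_comp hW hkm N)) (fun N => measurable_const)
    (tendsto_eLpNorm_one_add (fun N => measurable_empMean_comp hW (hgm N) N)
      (fun N => measurable_empMean_comp hW hkm N) h1' h2) h3
  refine h5.congr' ?_
  filter_upwards [eventually_ne_atTop 0] with N hN
  congr 1
  ext ω
  simp only [Pi.add_apply, hgdef, hkdef, empMean_sub, empMean_const hN]
  ring

/-- **Central limit theorem for ratio estimators.** Ratio of empirical means of functions that
depend on the sample size and converge in `L²`, corrected by products of centered empirical means. -/
theorem tendstoInDistribution_ratio (hW : ∀ i, MeasurePreserving (W i) μ ν)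
    (hind : iIndepFun W μ) {n d p q p' q' : ℕ → 𝒲 → ℝ} {n₀ d₀ : 𝒲 → ℝ}
    (hnm : ∀ N, Measurable (n N)) (hdm : ∀ N, Measurable (d N))
    (hn₀m : Measurable n₀) (hd₀m : Measurable d₀) (hn₀ : MemLp n₀ 2 ν) (hd₀ : MemLp d₀ 2 ν)
    (hn : Tendsto (fun N => eLpNorm (fun w => n N w - n₀ w) 2 ν) atTop (𝓝 0))
    (hd : Tendsto (fun N => eLpNorm (fun w => d N w - d₀ w) 2 ν) atTop (𝓝 0))
    (hp : CenteredL2Bounded ν p) (hq : CenteredL2Bounded ν q)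
    (hp' : CenteredL2Bounded ν p') (hq' : CenteredL2Bounded ν q')
    (hv : ∫ w, d₀ w ∂ν ≠ 0) :
    TendstoInDistribution (fun (N : ℕ) ω => √N *
      ((empMean N (fun i => n N (W i ω)) -
          empMean N (fun i => p N (W i ω)) * empMean N (fun i => q N (W i ω))) /
        (empMean N (fun i => d N (W i ω)) -
          empMean N (fun i => p' N (W i ω)) * empMean N (fun i => q' N (W i ω))) -
        (∫ w, n N w ∂ν) / ∫ w, d N w ∂ν)) atTop (id : ℝ → ℝ) (fun _ => μ)
      (gaussianReal 0 (variance (fun w => n₀ w - (∫ w, n₀ w ∂ν) / (∫ w, d₀ w ∂ν) * d₀ w) ν /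
        (∫ w, d₀ w ∂ν) ^ 2).toNNReal) := by
  have hEn := tendsto_integral_of_tendsto_eLpNorm_sub (by norm_num) hnm hn₀ hn
  have hEd := tendsto_integral_of_tendsto_eLpNorm_sub (by norm_num) hdm hd₀ hd
  have hnL := memLp_of_tendsto_eLpNorm_sub hnm hn₀ hn
  have hdL := memLp_of_tendsto_eLpNorm_sub hdm hd₀ hd
  have hES := hEn.div hEd hv
  set v := ∫ w, d₀ w ∂ν with hvdef
  set S₀ := (∫ w, n₀ w ∂ν) / v with hS₀
  set S : ℕ → ℝ := fun N => (∫ w, n N w ∂ν) / ∫ w, d N w ∂ν with hS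
  change Tendsto S atTop (𝓝 S₀) at hES
  set u : 𝒲 → ℝ := fun w => n₀ w - S₀ * d₀ w with hu
  set B : ℕ → Ω → ℝ := fun N ω => empMean N (fun i => d N (W i ω)) -
    empMean N (fun i => p' N (W i ω)) * empMean N (fun i => q' N (W i ω)) with hBdef
  have hum : Measurable u := hn₀m.sub (hd₀m.const_mul _)
  have huL : MemLp u 2 ν := hn₀.sub (hd₀.const_mul _)
  have h12 : (1 : ENNReal) ≤ 2 := by norm_num
  have hu0 : ∫ w, u w ∂ν = 0 := by
    simp only [hu]
    rw [integral_sub (hn₀.integrable h12) ((hd₀.integrable h12).const_mul _), integral_const_mul,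
      ← hvdef, hS₀, div_mul_cancel₀ _ hv, sub_self]
  have hmean : ∀ (g : ℕ → 𝒲 → ℝ), (∀ N, Measurable (g N)) → ∀ N,
      Measurable (fun ω => empMean N (fun i => g N (W i ω))) :=
    fun g hg N => measurable_empMean_comp hW (hg N) N
  -- central limit theorem for the linearization
  have hvarW : variance (fun ω => u (W 0 ω)) μ = variance u ν :=
    variance_comp_of_measurePreserving (hW 0) hum
  -- The Gaussian limit of variance `Var u` is realized as `v * x` with `x` of variance `Var u /
  -- v²`, so that dividing by `v` returns the identity map.
  have hlaw : HasLaw (fun x : ℝ => v * x)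
      (gaussianReal 0 (variance (fun ω => u (W 0 ω)) μ).toNNReal)
      (gaussianReal 0 (variance u ν / v ^ 2).toNNReal) := by
    have h := gaussianReal_const_mul (HasLaw.id (μ := gaussianReal 0 (variance u ν / v ^ 2).toNNReal)) v
    rw [mul_zero] at h
    suffices hvar : (variance (fun ω => u (W 0 ω)) μ).toNNReal =
        NNReal.mk (v ^ 2) (sq_nonneg v) * (variance u ν / v ^ 2).toNNReal by
      rw [hvar]
      exact h
    rw [hvarW]
    ext
    have := variance_nonneg u ν
    simp only [NNReal.coe_mul, NNReal.coe_mk]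
    rw [Real.coe_toNNReal _ this, Real.coe_toNNReal _ (by positivity)]
    field_simp
  have hM : TendstoInDistribution (fun (N : ℕ) ω => √N * empMean N (fun i => u (W i ω))) atTop
      (fun x : ℝ => v * x) (fun _ => μ) (gaussianReal 0 (variance u ν / v ^ 2).toNNReal) := by
    have h := tendstoInDistribution_inv_sqrt_mul_sum_sub (X := fun i ω => u (W i ω)) hlaw
      (huL.comp_measurePreserving (hW 0)) (hind.comp (fun _ => u) fun _ => hum)
      (fun i => ⟨(hum.comp (hW i).measurable).aemeasurable,
        (hum.comp (hW 0).measurable).aemeasurable, by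
          change μ.map (u ∘ W i) = μ.map (u ∘ W 0)
          rw [← Measure.map_map hum (hW i).measurable, ← Measure.map_map hum (hW 0).measurable,
            (hW i).map_eq, (hW 0).map_eq]⟩)
    refine h.congr (fun N => Eventually.of_forall fun ω => ?_) .rfl
    simp only [integral_comp_of_measurePreserving (hW 0) hum, hu0, mul_zero, sub_zero, empMean]
    rw [← mul_assoc]
    congr 1
    rw [mul_one_div, Real.sqrt_div_self', one_div]
  -- convergence of the denominator
  have hB : TendstoInMeasure μ B atTop (fun _ => v) := by
    have h1 := tendsto_eLpNorm_empMean_sub hW hind hdm hd₀m hd₀ hd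
    have h2 := tendsto_eLpNorm_sqrt_mul_empMean_mul_empMean hW hind hp' hq'
    -- The product of means vanishes even after multiplication by `√N ≥ 1`, hence also without it.
    have h2' : Tendsto (fun N : ℕ => eLpNorm (fun ω => -1 * (empMean N (fun i => p' N (W i ω)) *
        empMean N (fun i => q' N (W i ω)))) 1 μ) atTop (𝓝 0) := by
      refine tendsto_of_tendsto_of_tendsto_of_le_of_le' tendsto_const_nhds h2
        (Eventually.of_forall fun _ => zero_le) ?_
      filter_upwards [eventually_ge_atTop 1] with N hN
      refine eLpNorm_mono fun ω => ?_
      rw [norm_mul, norm_mul √(N : ℝ)]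
      refine mul_le_mul_of_nonneg_right ?_ (norm_nonneg _)
      rw [Real.norm_of_nonneg (Real.sqrt_nonneg _), norm_neg, norm_one]
      exact Real.one_le_sqrt.2 (by exact_mod_cast hN)
    refine tendstoInMeasure_of_tendsto_eLpNorm (p := 1) one_ne_zero
      (fun N => ((hmean d hdm N).sub ((hmean p' hp'.1 N).mul (hmean q' hq'.1 N))).aestronglyMeasurable)
      aestronglyMeasurable_const ?_
    refine (tendsto_eLpNorm_one_add (fun N => (hmean d hdm N).sub_const _)
      (fun N => ((hmean p' hp'.1 N).mul (hmean q' hq'.1 N)).const_mul _) h1 h2').congr fun N => ?_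
    congr 1
    ext ω
    simp only [Pi.add_apply, Pi.sub_apply, Pi.mul_apply, hBdef]
    ring
  -- the remainder
  set g : ℕ → 𝒲 → ℝ := fun N w => (n N w - S N * d N w) - u w with hg
  have hgm : ∀ N, Measurable (g N) := fun N => ((hnm N).sub ((hdm N).const_mul _)).sub hum
  -- Centering at `S N` rather than at `S₀` makes this mean exactly zero, once `∫ d N ≠ 0`; a
  -- nonzero bias would be amplified by `√N`.
  have hg0 : ∀ᶠ N in atTop, ∫ w, g N w ∂ν = 0 := by
    filter_upwards [hnL, hdL, hEd.eventually_ne hv] with N h1 h2 h3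
    simp only [hg]
    have h4 : Integrable (fun w => n N w - S N * d N w) ν :=
      (h1.integrable h12).sub ((h2.integrable h12).const_mul _)
    rw [integral_sub h4 (huL.integrable h12), integral_sub (h1.integrable h12) ((h2.integrable h12).const_mul _),
      integral_const_mul, hu0, sub_zero]
    simp only [hS]
    rw [div_mul_cancel₀ _ h3, sub_self]
  have hg2 : Tendsto (fun N => eLpNorm (g N) 2 ν) atTop (𝓝 0) := by
    have e1 : Tendsto (fun N => ‖S N‖ₑ * eLpNorm (fun w => d N w - d₀ w) 2 ν) atTop (𝓝 0) := by
      simpa using ENNReal.Tendsto.mul hES.enorm (Or.inr ENNReal.zero_ne_top) hd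
        (Or.inr (by simp))
    have e2 : Tendsto (fun N => ‖S N - S₀‖ₑ * eLpNorm d₀ 2 ν) atTop (𝓝 0) := by
      have : Tendsto (fun N => ‖S N - S₀‖ₑ) atTop (𝓝 0) := by simpa using (hES.sub_const S₀).enorm
      simpa using ENNReal.Tendsto.mul_const this (Or.inr hd₀.2.ne)
    refine tendsto_of_tendsto_of_tendsto_of_le_of_le tendsto_const_nhds
      (by simpa using (hn.add e1).add e2) (fun _ => zero_le) fun N => ?_
    -- Three small terms: two `L²` errors, the second with bounded coefficient `S N`, and the fixed
    -- `d₀` with coefficient tending to `0`.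
    have e3 : g N = ((fun w => n N w - n₀ w) - S N • fun w => d N w - d₀ w) -
        (S N - S₀) • d₀ := by
      ext w
      simp only [hg, hu, Pi.sub_apply, Pi.smul_apply, smul_eq_mul]
      ring
    have m1 : AEStronglyMeasurable (fun w => n N w - n₀ w) ν :=
      ((hnm N).sub hn₀m).aestronglyMeasurable
    have m2 : AEStronglyMeasurable (S N • fun w => d N w - d₀ w) ν :=
      (((hdm N).sub hd₀m).const_smul _).aestronglyMeasurable
    have m3 : AEStronglyMeasurable ((S N - S₀) • d₀) ν := (hd₀m.const_smul _).aestronglyMeasurable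
    rw [e3]
    refine (eLpNorm_sub_le (m1.sub m2) m3 h12).trans ?_
    refine (add_le_add_left (eLpNorm_sub_le m1 m2 h12) _).trans ?_
    rw [eLpNorm_const_smul, eLpNorm_const_smul]
  set R : ℕ → Ω → ℝ := fun N ω => √N * empMean N (fun i => g N (W i ω)) +
    (-1 * (√N * (empMean N (fun i => p N (W i ω)) * empMean N (fun i => q N (W i ω)))) +
      S N * (√N * (empMean N (fun i => p' N (W i ω)) * empMean N (fun i => q' N (W i ω)))))
    with hR
  have hRm : ∀ N, Measurable (R N) := fun N =>
    ((hmean g hgm N).const_mul _).add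
      (((((hmean p hp.1 N).mul (hmean q hq.1 N)).const_mul _).const_mul _).add
        ((((hmean p' hp'.1 N).mul (hmean q' hq'.1 N)).const_mul _).const_mul _))
  have hH : TendstoInMeasure μ R atTop 0 := by
    refine tendstoInMeasure_of_tendsto_eLpNorm (p := 1) one_ne_zero
      (fun N => (hRm N).aestronglyMeasurable) aestronglyMeasurable_zero ?_
    simp only [sub_zero]
    exact tendsto_eLpNorm_one_add (fun N => (hmean g hgm N).const_mul _)
      (fun N => ((((hmean p hp.1 N).mul (hmean q hq.1 N)).const_mul _).const_mul _).add
        ((((hmean p' hp'.1 N).mul (hmean q' hq'.1 N)).const_mul _).const_mul _))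
      (tendsto_eLpNorm_sqrt_mul_empMean hW hind hgm hg0 hg2)
      (tendsto_eLpNorm_one_add
        (fun N => (((hmean p hp.1 N).mul (hmean q hq.1 N)).const_mul _).const_mul _)
        (fun N => (((hmean p' hp'.1 N).mul (hmean q' hq'.1 N)).const_mul _).const_mul _)
        (tendsto_eLpNorm_one_mul_of_bounded tendsto_const_nhds
          (tendsto_eLpNorm_sqrt_mul_empMean_mul_empMean hW hind hp hq))
        (tendsto_eLpNorm_one_mul_of_bounded hES
          (tendsto_eLpNorm_sqrt_mul_empMean_mul_empMean hW hind hp' hq')))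
  have hBm : ∀ N, Measurable (B N) := fun N =>
    (hmean d hdm N).sub ((hmean p' hp'.1 N).mul (hmean q' hq'.1 N))
  have key := tendstoInDistribution_of_mul_eq_add (Q := fun (N : ℕ) ω => √N *
      ((empMean N (fun i => n N (W i ω)) -
          empMean N (fun i => p N (W i ω)) * empMean N (fun i => q N (W i ω))) / B N ω - S N))
    hv hM hB hH
    (fun N => ((((hmean n hnm N).sub ((hmean p hp.1 N).mul (hmean q hq.1 N))).div
      (hBm N)).sub_const _).const_mul _) hBm ?_
  · refine key.congr (fun N => .rfl) (Eventually.of_forall fun x => ?_)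
    simp only [id]
    field_simp
  · refine Eventually.of_forall fun N ω hb => ?_
    have e1 : (√(N : ℝ) * ((empMean N (fun i => n N (W i ω)) -
          empMean N (fun i => p N (W i ω)) * empMean N (fun i => q N (W i ω))) / B N ω - S N)) *
          B N ω = √N * ((empMean N (fun i => n N (W i ω)) -
          empMean N (fun i => p N (W i ω)) * empMean N (fun i => q N (W i ω))) - S N * B N ω) := by
      field_simp
    rw [e1]
    simp only [hR, hg, empMean_sub, empMean_const_mul, hBdef]
    ring

end RatioCLT

/-! ### From `L²` to `L⁴` convergence, and products of `L⁴` functions -/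

section Interpolation

variable {𝒲 : Type*} [MeasurableSpace 𝒲] {ν : Measure 𝒲}

instance holderTriple_four_four_two : ENNReal.HolderTriple 4 4 2 where
  inv_add_inv_eq_inv := by
    rw [← two_mul, show (4 : ENNReal) = 2 * 2 by norm_num,
      ENNReal.mul_inv (by simp) (by simp), ← mul_assoc, ENNReal.mul_inv_cancel (by simp) (by simp),
      one_mul]

lemma eLpNorm_rpow_toReal (h : 𝒲 → ℝ) {p : ENNReal} (h0 : p ≠ 0) (htop : p ≠ ⊤) :
    eLpNorm h p ν ^ p.toReal = ∫⁻ w, ‖h w‖ₑ ^ p.toReal ∂ν := by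
  rw [eLpNorm_eq_lintegral_rpow_enorm_toReal h0 htop, ← ENNReal.rpow_mul, one_div,
    inv_mul_cancel₀ (ENNReal.toReal_pos h0 htop).ne', ENNReal.rpow_one]

/-- Interpolation of the `L⁴` norm between `L²` and `L^(4 + s)`. -/
lemma eLpNorm_four_rpow_le {s : ℝ} (hs : 0 < s) {h : 𝒲 → ℝ} (hm : AEStronglyMeasurable h ν) :
    eLpNorm h 4 ν ^ (4 : ℝ) ≤ (eLpNorm h 2 ν ^ (2 : ℝ)) ^ (s / (2 + s)) *
      (eLpNorm h (ENNReal.ofReal (4 + s)) ν ^ (4 + s)) ^ (2 / (2 + s)) := by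
  have hq : (ENNReal.ofReal (4 + s)).toReal = 4 + s := ENNReal.toReal_ofReal (by positivity)
  have e4 := eLpNorm_rpow_toReal (ν := ν) h (p := 4) (by simp) (by simp)
  have e2 := eLpNorm_rpow_toReal (ν := ν) h (p := 2) (by simp) (by simp)
  have eq := eLpNorm_rpow_toReal (ν := ν) h (p := ENNReal.ofReal (4 + s))
    (by simpa using by positivity) (by simp)
  rw [hq] at eq
  simp only [ENNReal.toReal_ofNat] at e4 e2
  rw [e4, e2, eq]
  have hsum : s / (2 + s) + 2 / (2 + s) = 1 := by field_simp; ring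
  refine le_trans (le_of_eq ?_) (ENNReal.lintegral_mul_norm_pow_le
    (f := fun w => ‖h w‖ₑ ^ (2 : ℝ)) (g := fun w => ‖h w‖ₑ ^ (4 + s))
    (hm.enorm.pow_const _) (hm.enorm.pow_const _) (p := s / (2 + s)) (q := 2 / (2 + s))
    (by positivity) (by positivity) hsum)
  -- The weights are chosen so that `2 * s / (2 + s) + (4 + s) * 2 / (2 + s) = 4`.
  refine lintegral_congr fun w => ?_
  rw [← ENNReal.rpow_mul, ← ENNReal.rpow_mul, ← ENNReal.rpow_add_of_nonneg _ _ (by positivity)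
    (by positivity)]
  congr 1
  field_simp
  ring

/-- A sequence bounded in `L^(4 + s)` that converges in `L²` has its limit in `L^(4 + s)` and
converges in `L⁴`. -/
lemma tendsto_eLpNorm_four [IsProbabilityMeasure ν] {s : ℝ} (hs : 0 < s) {f : ℕ → 𝒲 → ℝ}
    {g : 𝒲 → ℝ} (hf : ∀ N, Measurable (f N)) (hg : Measurable g) {K : ENNReal} (hK : K ≠ ⊤)
    (hb : ∀ᶠ N in atTop, eLpNorm (f N) (ENNReal.ofReal (4 + s)) ν ≤ K)
    (h2 : Tendsto (fun N => eLpNorm (fun w => f N w - g w) 2 ν) atTop (𝓝 0)) :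
    MemLp g 4 ν ∧ Tendsto (fun N => eLpNorm (fun w => f N w - g w) 4 ν) atTop (𝓝 0) := by
  have hq1 : 1 ≤ ENNReal.ofReal (4 + s) := by
    rw [ENNReal.one_le_ofReal]; linarith
  have hq4 : 4 ≤ ENNReal.ofReal (4 + s) := by
    rw [show (4 : ENNReal) = ENNReal.ofReal 4 by simp]
    exact ENNReal.ofReal_le_ofReal (by linarith)
  have hmeas : TendstoInMeasure ν f atTop g :=
    tendstoInMeasure_of_tendsto_eLpNorm two_ne_zero (fun N => (hf N).aestronglyMeasurable)
      hg.aestronglyMeasurable h2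
  -- Fatou-type lower semicontinuity: the limit inherits the bound `K`.
  have hgK := eLpNorm_le_of_tendstoInMeasure hb hmeas fun N => (hf N).aestronglyMeasurable
  have hgL : MemLp g (ENNReal.ofReal (4 + s)) ν :=
    ⟨hg.aestronglyMeasurable, hgK.trans_lt hK.lt_top⟩
  refine ⟨hgL.mono_exponent hq4, ?_⟩
  have hlim : Tendsto (fun N => (eLpNorm (fun w => f N w - g w) 2 ν ^ (2 : ℝ)) ^ (s / (2 + s)) *
      ((K + K) ^ (4 + s)) ^ (2 / (2 + s))) atTop (𝓝 0) := by
    have h3 := (ENNReal.continuous_rpow_const (y := s / (2 + s))).tendsto _ |>.comp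
      ((ENNReal.continuous_rpow_const (y := 2)).tendsto _ |>.comp h2)
    have h4 : ((0 : ENNReal) ^ (2 : ℝ)) ^ (s / (2 + s)) = 0 := by
      rw [ENNReal.zero_rpow_of_pos (by norm_num), ENNReal.zero_rpow_of_pos (by positivity)]
    rw [h4] at h3
    have h5 : ((K + K) ^ (4 + s)) ^ (2 / (2 + s)) ≠ ⊤ :=
      ENNReal.rpow_ne_top_of_nonneg (by positivity)
        (ENNReal.rpow_ne_top_of_nonneg (by positivity) (by simp [hK]))
    simpa using ENNReal.Tendsto.mul_const h3 (Or.inr h5)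
  have h4 : Tendsto (fun N => eLpNorm (fun w => f N w - g w) 4 ν ^ (4 : ℝ)) atTop (𝓝 0) := by
    refine tendsto_of_tendsto_of_tendsto_of_le_of_le' tendsto_const_nhds hlim
      (Eventually.of_forall fun _ => zero_le) ?_
    filter_upwards [hb] with N hN
    refine (eLpNorm_four_rpow_le hs ((hf N).sub hg).aestronglyMeasurable).trans ?_
    gcongr ?_ * (?_ ^ (4 + s)) ^ (2 / (2 + s))
    · exact le_rfl
    exact (eLpNorm_sub_le (hf N).aestronglyMeasurable hg.aestronglyMeasurable hq1).trans
      (add_le_add hN hgK)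
  have h5 := (ENNReal.continuous_rpow_const (y := (4 : ℝ)⁻¹)).tendsto _ |>.comp h4
  rw [ENNReal.zero_rpow_of_pos (by norm_num)] at h5
  refine h5.congr fun N => ?_
  simp only [Function.comp]
  rw [← ENNReal.rpow_mul, mul_inv_cancel₀ (by norm_num), ENNReal.rpow_one]

lemma tendsto_eLpNorm_bounded {p : ENNReal} (hp : 1 ≤ p) {f : ℕ → 𝒲 → ℝ} {g : 𝒲 → ℝ}
    (hf : ∀ N, Measurable (f N)) (hg : MemLp g p ν)
    (h : Tendsto (fun N => eLpNorm (fun w => f N w - g w) p ν) atTop (𝓝 0)) :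
    ∀ᶠ N in atTop, eLpNorm (f N) p ν ≤ 1 + eLpNorm g p ν := by
  filter_upwards [h.eventually_lt_const (zero_lt_one (α := ENNReal))] with N hN
  have : f N = (fun w => f N w - g w) + g := by ext w; simp
  rw [this]
  exact (eLpNorm_add_le ((hf N).aestronglyMeasurable.sub hg.1) hg.1 hp).trans
    (add_le_add_left hN.le _)

/-- Products of sequences that converge in `L⁴` converge in `L²`. -/
lemma tendsto_eLpNorm_mul_sub_mul {f g : ℕ → 𝒲 → ℝ} {f₀ g₀ : 𝒲 → ℝ}
    (hf : ∀ N, Measurable (f N)) (hg : ∀ N, Measurable (g N)) (hf₀ : MemLp f₀ 4 ν)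
    (hg₀ : MemLp g₀ 4 ν)
    (hfl : Tendsto (fun N => eLpNorm (fun w => f N w - f₀ w) 4 ν) atTop (𝓝 0))
    (hgl : Tendsto (fun N => eLpNorm (fun w => g N w - g₀ w) 4 ν) atTop (𝓝 0)) :
    Tendsto (fun N => eLpNorm (fun w => f N w * g N w - f₀ w * g₀ w) 2 ν) atTop (𝓝 0) := by
  have h1 := ENNReal.Tendsto.mul_const (b := 1 + eLpNorm g₀ 4 ν) hfl
    (Or.inr (by simp [hg₀.2.ne]))
  have h2 := ENNReal.Tendsto.const_mul (a := eLpNorm f₀ 4 ν) hgl (Or.inr hf₀.2.ne)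
  refine tendsto_of_tendsto_of_tendsto_of_le_of_le' tendsto_const_nhds
    (by simpa using h1.add h2) (Eventually.of_forall fun _ => zero_le) ?_
  filter_upwards [tendsto_eLpNorm_bounded (by norm_num) hg hg₀ hgl] with N hN
  -- Each term has one small and one bounded factor in `L⁴`; Hölder with `1/4 + 1/4 = 1/2` applies
  -- to both.
  have e : (fun w => f N w * g N w - f₀ w * g₀ w) =
      (fun w => f N w - f₀ w) • g N + f₀ • (fun w => g N w - g₀ w) := by
    ext w
    simp only [Pi.add_apply, Pi.mul_apply, smul_eq_mul]
    ring
  have m1 : AEStronglyMeasurable (fun w => f N w - f₀ w) ν :=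
    (hf N).aestronglyMeasurable.sub hf₀.1
  have m2 : AEStronglyMeasurable (fun w => g N w - g₀ w) ν :=
    (hg N).aestronglyMeasurable.sub hg₀.1
  rw [e]
  refine (eLpNorm_add_le (m1.smul (hg N).aestronglyMeasurable) (hf₀.1.smul m2) (by norm_num)).trans
    (add_le_add ((eLpNorm_smul_le_mul_eLpNorm (p := 4) (q := 4)
      (hg N).aestronglyMeasurable m1).trans ?_)
      (eLpNorm_smul_le_mul_eLpNorm (p := 4) (q := 4) m2 hf₀.1))
  gcongr

/-- Half-sums of sequences that converge in `L^p` converge in `L^p`. -/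
lemma tendsto_eLpNorm_half_add_sub {p : ENNReal} (hp : 1 ≤ p) {f g : ℕ → 𝒲 → ℝ} {f₀ g₀ : 𝒲 → ℝ}
    (hf : ∀ N, Measurable (f N)) (hg : ∀ N, Measurable (g N)) (hf₀ : Measurable f₀)
    (hg₀ : Measurable g₀)
    (hfl : Tendsto (fun N => eLpNorm (fun w => f N w - f₀ w) p ν) atTop (𝓝 0))
    (hgl : Tendsto (fun N => eLpNorm (fun w => g N w - g₀ w) p ν) atTop (𝓝 0)) :
    Tendsto (fun N => eLpNorm (fun w => (f N w + g N w) / 2 - (f₀ w + g₀ w) / 2) p ν)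
      atTop (𝓝 0) := by
  have h := ENNReal.Tendsto.const_mul (a := ‖(1 / 2 : ℝ)‖ₑ) (hfl.add hgl) (Or.inr (by simp))
  rw [add_zero, mul_zero] at h
  refine tendsto_of_tendsto_of_tendsto_of_le_of_le tendsto_const_nhds h (fun _ => zero_le) fun N => ?_
  have e : (fun w => (f N w + g N w) / 2 - (f₀ w + g₀ w) / 2) =
      (1 / 2 : ℝ) • ((fun w => f N w - f₀ w) + fun w => g N w - g₀ w) := by
    ext w
    simp only [Pi.add_apply, Pi.smul_apply, smul_eq_mul]
    ring
  rw [e, eLpNorm_const_smul]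
  gcongr
  exact eLpNorm_add_le ((hf N).sub hf₀).aestronglyMeasurable ((hg N).sub hg₀).aestronglyMeasurable hp

/-- Centering preserves convergence in `L^p`. -/
lemma tendsto_eLpNorm_centered [IsProbabilityMeasure ν] {p : ENNReal} (hp : 1 ≤ p)
    {f : ℕ → 𝒲 → ℝ} {g : 𝒲 → ℝ} (hf : ∀ N, Measurable (f N)) (hg : MemLp g p ν)
    (h : Tendsto (fun N => eLpNorm (fun w => f N w - g w) p ν) atTop (𝓝 0)) :
    Tendsto (fun N => eLpNorm (fun w => (f N w - ∫ x, f N x ∂ν) - (g w - ∫ x, g x ∂ν)) p ν)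
      atTop (𝓝 0) := by
  have hE := ((tendsto_integral_of_tendsto_eLpNorm_sub hp hf hg h).sub_const (∫ x, g x ∂ν)).enorm
  refine tendsto_of_tendsto_of_tendsto_of_le_of_le tendsto_const_nhds
    (by simpa using h.add hE) (fun _ => zero_le) fun N => ?_
  have e : (fun w => (f N w - ∫ x, f N x ∂ν) - (g w - ∫ x, g x ∂ν)) =
      (fun w => f N w - g w) - fun _ => (∫ x, f N x ∂ν) - ∫ x, g x ∂ν := by
    ext w
    simp only [Pi.sub_apply]
    ring
  rw [e]
  refine (eLpNorm_sub_le ((hf N).aestronglyMeasurable.sub hg.1) aestronglyMeasurable_const hp).trans ?_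
  rw [eLpNorm_const _ (by positivity) (NeZero.ne ν)]
  simp only [measure_univ, ENNReal.one_rpow, mul_one]
  rfl

end Interpolation

/-! ### The Sobol index as a pick-freeze covariance -/

section SobolIndex

variable {Ω 𝒳 ℛ : Type*} [MeasurableSpace Ω] [m𝒳 : MeasurableSpace 𝒳] [MeasurableSpace ℛ]
  {P : Measure Ω} [IsProbabilityMeasure P] {X : Ω → 𝒳} {R R' : Ω → ℛ} {κ : Measure 𝒳}
  {ρ : Measure ℛ} [IsProbabilityMeasure κ] [IsProbabilityMeasure ρ]

/-- The conditional expectation of `F (X, R)` given `X`, where `X` and `R` are independent, is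
obtained by integrating out `R`. -/
lemma condExp_comp_prod_ae_eq (hX : Measurable X)
    (hXR : MeasurePreserving (fun ω => (X ω, R ω)) P (κ.prod ρ)) {F : 𝒳 × ℛ → ℝ}
    (hF : Measurable F) (hint : Integrable F (κ.prod ρ)) :
    P[fun ω => F (X ω, R ω) | m𝒳.comap X] =ᵐ[P] fun ω => ∫ r, F (X ω, r) ∂ρ := by
  have hXκ : MeasurePreserving X P κ := measurePreserving_fst.comp hXR
  have hg : StronglyMeasurable (fun x => ∫ r, F (x, r) ∂ρ) :=
    hF.stronglyMeasurable.integral_prod_right'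
  have hgint : Integrable (fun ω => ∫ r, F (X ω, r) ∂ρ) P :=
    hXκ.integrable_comp_of_integrable hint.integral_prod_left
  refine (ae_eq_condExp_of_forall_setIntegral_eq hX.comap_le
    (hXR.integrable_comp_of_integrable hint) (fun _ _ _ => hgint.integrableOn) ?_ ?_).symm
  · rintro _ ⟨t, ht, rfl⟩ -
    have h1 : ∫ ω in X ⁻¹' t, F (X ω, R ω) ∂P = ∫ z in t ×ˢ Set.univ, F z ∂(κ.prod ρ) := by
      rw [← hXR.map_eq, setIntegral_map (ht.prod MeasurableSet.univ) hF.aestronglyMeasurable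
        hXR.aemeasurable]
      congr 2
      ext ω
      simp
    have h2 : ∫ ω in X ⁻¹' t, (∫ r, F (X ω, r) ∂ρ) ∂P = ∫ x in t, ∫ r, F (x, r) ∂ρ ∂κ := by
      rw [← hXκ.map_eq, setIntegral_map ht hg.aestronglyMeasurable hXκ.aemeasurable]
    change _ = ∫ ω in X ⁻¹' t, F (X ω, R ω) ∂P
    rw [h1, h2, setIntegral_prod _ hint.integrableOn]
    simp
  · exact (hg.comp_measurable (comap_measurable X)).aestronglyMeasurable

/-- **Pick-freeze identity**: the variance of `E(F (X, R) | X)` is the covariance of `F (X, R)` and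
`F (X, R')`, where `R'` is an independent copy of `R`. -/
lemma variance_condExp_eq_integral_mul (hX : Measurable X)
    (hXRR : MeasurePreserving (fun ω => (X ω, R ω, R' ω)) P (κ.prod (ρ.prod ρ))) {F : 𝒳 × ℛ → ℝ}
    (hF : Measurable F) (hL : MemLp F 2 (κ.prod ρ)) {m : ℝ} (hm : ∫ y, F y ∂(κ.prod ρ) = m) :
    variance (P[fun ω => F (X ω, R ω) | m𝒳.comap X]) P =
      ∫ z, (F (z.1, z.2.1) - m) * (F (z.1, z.2.2) - m) ∂(κ.prod (ρ.prod ρ)) := by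
  have hp1 : MeasurePreserving (fun z : 𝒳 × ℛ × ℛ => (z.1, z.2.1)) (κ.prod (ρ.prod ρ)) (κ.prod ρ) :=
    (MeasurePreserving.id κ).prod measurePreserving_fst
  have hp2 : MeasurePreserving (fun z : 𝒳 × ℛ × ℛ => (z.1, z.2.2)) (κ.prod (ρ.prod ρ)) (κ.prod ρ) :=
    (MeasurePreserving.id κ).prod measurePreserving_snd
  have hXR : MeasurePreserving (fun ω => (X ω, R ω)) P (κ.prod ρ) := hp1.comp hXRR
  have hXκ : MeasurePreserving X P κ := measurePreserving_fst.comp hXR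
  have hint : Integrable F (κ.prod ρ) := hL.integrable (by norm_num)
  have hce := condExp_comp_prod_ae_eq hX hXR hF hint
  have hg : StronglyMeasurable (fun x => ∫ r, F (x, r) ∂ρ) :=
    hF.stronglyMeasurable.integral_prod_right'
  have hEg : ∫ ω, (∫ r, F (X ω, r) ∂ρ) ∂P = m := by
    rw [← integral_congr_ae hce, integral_condExp hX.comap_le, ← hm, ← hXR.map_eq,
      integral_map hXR.aemeasurable hF.aestronglyMeasurable]
  have hgX : Measurable (fun ω => ∫ r, F (X ω, r) ∂ρ) := hg.measurable.comp hX
  rw [variance_congr hce, variance_eq_integral hgX.aemeasurable, hEg]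
  have e1 : ∫ ω, ((∫ r, F (X ω, r) ∂ρ) - m) ^ 2 ∂P = ∫ x, ((∫ r, F (x, r) ∂ρ) - m) ^ 2 ∂κ := by
    rw [← hXκ.map_eq, integral_map hXκ.aemeasurable
      ((hg.measurable.sub_const m).pow_const 2).aestronglyMeasurable]
  have hI : Integrable (fun z : 𝒳 × ℛ × ℛ => (F (z.1, z.2.1) - m) * (F (z.1, z.2.2) - m))
      (κ.prod (ρ.prod ρ)) :=
    MemLp.integrable_mul ((hL.comp_measurePreserving hp1).sub (memLp_const m))
      ((hL.comp_measurePreserving hp2).sub (memLp_const m))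
  rw [e1, integral_prod _ hI]
  refine integral_congr_ae ?_
  filter_upwards [hint.prod_right_ae] with x hx
  -- With `x` frozen, the two copies of `R` are independent with the same law, so the inner integral
  -- is a square.
  rw [integral_prod_mul (fun r => F (x, r) - m) (fun r => F (x, r) - m),
    integral_sub hx (integrable_const _)]
  simp
  ring

end SobolIndex

/-! ### Translation invariance of the estimators and centered outputs -/

section Centering

/-- Empirical covariances and variances ignore a common shift `m`. With `m` the true mean, the
subtracted products become products of centered means, negligible at scale `√N`. -/
lemma estimS_eq_centered {N : ℕ} (hN : N ≠ 0) (m : ℝ) (y y' : ℕ → ℝ) :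
    estimS N y y' =
      (empMean N (fun i => (y i - m) * (y' i - m)) -
          empMean N (fun i => y i - m) * empMean N (fun i => y' i - m)) /
        (empMean N (fun i => (y i - m) ^ 2) -
          empMean N (fun i => y i - m) * empMean N (fun i => y i - m)) := by
  have e1 : (fun i => (y i - m) * (y' i - m)) =
      fun i => y i * y' i - m * y i - m * y' i + m * m := by ext i; ring
  have e2 : (fun i => (y i - m) ^ 2) = fun i => y i ^ 2 - 2 * m * y i + m * m := by ext i; ring
  rw [e1, e2, estimS]
  simp only [empMean_add, empMean_sub, empMean_const_mul, empMean_const hN]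
  congr 1 <;> ring

lemma estimT_eq_centered {N : ℕ} (hN : N ≠ 0) (m : ℝ) (y y' : ℕ → ℝ) :
    estimT N y y' =
      (empMean N (fun i => (y i - m) * (y' i - m)) -
          empMean N (fun i => ((y i - m) + (y' i - m)) / 2) *
            empMean N (fun i => ((y i - m) + (y' i - m)) / 2)) /
        (empMean N (fun i => ((y i - m) ^ 2 + (y' i - m) ^ 2) / 2) -
          empMean N (fun i => ((y i - m) + (y' i - m)) / 2) *
            empMean N (fun i => ((y i - m) + (y' i - m)) / 2)) := by
  have e1 : (fun i => (y i - m) * (y' i - m)) =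
      fun i => y i * y' i - m * y i - m * y' i + m * m := by ext i; ring
  have e2 : (fun i => ((y i - m) ^ 2 + (y' i - m) ^ 2) / 2) =
      fun i => (y i ^ 2 + y' i ^ 2) / 2 - m * y i - m * y' i + m * m := by ext i; ring
  have e3 : (fun i => ((y i - m) + (y' i - m)) / 2) =
      fun i => (1 / 2) * y i + (1 / 2) * y' i - m := by ext i; ring
  have e4 : (fun i => (y i + y' i) / 2) = fun i => (1 / 2) * y i + (1 / 2) * y' i := by
    ext i; ring
  rw [e1, e2, e3, estimT, e4]
  simp only [empMean_add, empMean_sub, empMean_const_mul, empMean_const hN]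
  congr 1 <;> ring

variable {𝒲 𝒴 : Type*} [MeasurableSpace 𝒲] [MeasurableSpace 𝒴] {ν : Measure 𝒲}
  [IsProbabilityMeasure ν] {lam : Measure 𝒴} [IsProbabilityMeasure lam]

lemma centeredL2Bounded_of_tendsto {f : ℕ → 𝒲 → ℝ} {g : 𝒲 → ℝ} (hf : ∀ N, Measurable (f N))
    (hg : MemLp g 4 ν) (h : Tendsto (fun N => eLpNorm (fun w => f N w - g w) 4 ν) atTop (𝓝 0))
    (h0 : ∀ᶠ N in atTop, ∫ w, f N w ∂ν = 0) : CenteredL2Bounded ν f := by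
  refine ⟨hf, 1 + eLpNorm g 4 ν, by simp [hg.2.ne], ?_⟩
  filter_upwards [tendsto_eLpNorm_bounded (by norm_num) hf hg h, h0] with N h1 h2
  exact ⟨(eLpNorm_le_eLpNorm_of_exponent_le
    (by exact_mod_cast (by norm_num : (2 : ℕ) ≤ 4)) (hf N).aestronglyMeasurable).trans h1, h2⟩

variable {τ : 𝒲 → 𝒴} {G : ℕ → 𝒴 → ℝ} {F : 𝒴 → ℝ}

-- The functions `F` and `F + c` have the same centered version; this is where the constant `c`
-- drops out.
omit [IsProbabilityMeasure ν] in
lemma tendsto_eLpNorm_centered_comp (hτ : MeasurePreserving τ ν lam)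
    (hG : ∀ N, Measurable (G N)) (hF : Measurable F) (hFL : MemLp F 4 lam) {c : ℝ}
    (h : Tendsto (fun N => eLpNorm (fun y => G N y - (F y + c)) 4 lam) atTop (𝓝 0)) :
    Tendsto (fun N => eLpNorm (fun w => (G N (τ w) - ∫ y, G N y ∂lam) -
      (F (τ w) - ∫ y, F y ∂lam)) 4 ν) atTop (𝓝 0) := by
  have h4 : (1 : ENNReal) ≤ 4 := by norm_num
  have hFc : MemLp (fun y => F y + c) 4 lam := hFL.add (memLp_const c)
  have h1 := tendsto_eLpNorm_centered h4 hG hFc h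
  refine h1.congr fun N => ?_
  have e : ∫ y, (F y + c) ∂lam = (∫ y, F y ∂lam) + c := by
    rw [integral_add (hFL.integrable h4) (integrable_const _)]
    simp
  rw [e, ← eLpNorm_comp_of_measurePreserving hτ
    (g := fun y => G N y - ∫ x, G N x ∂lam - ((F y + c) - ((∫ x, F x ∂lam) + c)))
    (((hG N).sub_const _).sub ((hF.add_const _).sub_const _))]
  congr 1
  ext w
  ring

omit [IsProbabilityMeasure lam] in
lemma memLp_centered_comp {p : ENNReal} (hτ : MeasurePreserving τ ν lam) (hFL : MemLp F p lam) :
    MemLp (fun w => F (τ w) - ∫ y, F y ∂lam) p ν :=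
  (hFL.comp_measurePreserving hτ).sub (memLp_const _)

omit [IsProbabilityMeasure ν] in
lemma integral_centered_comp (hτ : MeasurePreserving τ ν lam) (hF : Measurable F)
    (hFi : Integrable F lam) : ∫ w, (F (τ w) - ∫ y, F y ∂lam) ∂ν = 0 := by
  rw [integral_comp_of_measurePreserving hτ (g := fun x => F x - ∫ y, F y ∂lam) (hF.sub_const _),
    integral_sub hFi (integrable_const _)]
  simp

omit [IsProbabilityMeasure ν] [IsProbabilityMeasure lam] in
lemma integral_centered_comp_sq (hτ : MeasurePreserving τ ν lam) (hF : Measurable F) :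
    ∫ w, (F (τ w) - ∫ y, F y ∂lam) ^ 2 ∂ν = variance F lam := by
  rw [integral_comp_of_measurePreserving hτ (g := fun x => (F x - ∫ y, F y ∂lam) ^ 2)
    ((hF.sub_const _).pow_const 2), variance_eq_integral hF.aemeasurable]

end Centering

/-! ### Asymptotic normality of the two estimators -/

section PickFreeze

variable {Ω 𝒲 𝒴 : Type*} [MeasurableSpace Ω] [MeasurableSpace 𝒲] [MeasurableSpace 𝒴]
  {μ : Measure Ω} [IsProbabilityMeasure μ] {ν : Measure 𝒲} [IsProbabilityMeasure ν]
  {lam : Measure 𝒴} [IsProbabilityMeasure lam] {W : ℕ → Ω → 𝒲} {τ τ' : 𝒲 → 𝒴}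
  {G : ℕ → 𝒴 → ℝ} {F : 𝒴 → ℝ}

/-- Asymptotic normality of the first estimator, for a pair `(τ, τ')` of identically distributed
functions of the sample. -/
theorem tendstoInDistribution_estimS (hW : ∀ i, MeasurePreserving (W i) μ ν)
    (hind : iIndepFun W μ) (hτ : MeasurePreserving τ ν lam) (hτ' : MeasurePreserving τ' ν lam)
    (hG : ∀ N, Measurable (G N)) (hF : Measurable F) (hFL : MemLp F 4 lam) {c : ℝ}
    (h : Tendsto (fun N => eLpNorm (fun y => G N y - (F y + c)) 4 lam) atTop (𝓝 0))
    (hv : variance F lam ≠ 0) :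
    TendstoInDistribution (fun (N : ℕ) ω => √N *
      (estimS N (fun i => G N (τ (W i ω))) (fun i => G N (τ' (W i ω))) -
        (∫ w, (G N (τ w) - ∫ y, G N y ∂lam) * (G N (τ' w) - ∫ y, G N y ∂lam) ∂ν) /
          variance (G N) lam)) atTop (id : ℝ → ℝ) (fun _ => μ)
      (gaussianReal 0 (variance (fun w => (F (τ w) - ∫ y, F y ∂lam) *
        ((F (τ' w) - ∫ y, F y ∂lam) -
          (∫ w, (F (τ w) - ∫ y, F y ∂lam) * (F (τ' w) - ∫ y, F y ∂lam) ∂ν) / variance F lam *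
            (F (τ w) - ∫ y, F y ∂lam))) ν / variance F lam ^ 2).toNNReal) := by
  have h4 : (1 : ENNReal) ≤ 4 := by norm_num
  have hGL := memLp_of_tendsto_eLpNorm_sub hG (hFL.add (memLp_const c)) h
  have hGi : ∀ᶠ N in atTop, Integrable (G N) lam := hGL.mono fun N hN => hN.integrable h4
  have ha := tendsto_eLpNorm_centered_comp hτ hG hF hFL h
  have hb := tendsto_eLpNorm_centered_comp hτ' hG hF hFL h
  have haL := memLp_centered_comp hτ hFL
  have hbL := memLp_centered_comp hτ' hFL
  have ham : ∀ N, Measurable (fun w => G N (τ w) - ∫ y, G N y ∂lam) := fun N =>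
    ((hG N).comp hτ.measurable).sub_const _
  have hbm : ∀ N, Measurable (fun w => G N (τ' w) - ∫ y, G N y ∂lam) := fun N =>
    ((hG N).comp hτ'.measurable).sub_const _
  have ha₀ : Measurable (fun w => F (τ w) - ∫ y, F y ∂lam) :=
    (hF.comp hτ.measurable).sub_const _
  have hb₀ : Measurable (fun w => F (τ' w) - ∫ y, F y ∂lam) :=
    (hF.comp hτ'.measurable).sub_const _
  have hac := centeredL2Bounded_of_tendsto ham haL ha
    (hGi.mono fun N hN => integral_centered_comp hτ (hG N) hN)
  have hbc := centeredL2Bounded_of_tendsto hbm hbL hb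
    (hGi.mono fun N hN => integral_centered_comp hτ' (hG N) hN)
  have hn := tendsto_eLpNorm_mul_sub_mul ham hbm haL hbL ha hb
  have hd := tendsto_eLpNorm_mul_sub_mul ham ham haL haL ha ha
  simp only [← sq] at hd
  have hd₀L : MemLp (fun w => (F (τ w) - ∫ y, F y ∂lam) ^ 2) 2 ν := by
    simp only [sq]
    exact haL.mul (p := 4) (q := 4) haL
  have key := tendstoInDistribution_ratio hW hind (fun N => (ham N).mul (hbm N))
    (fun N => (ham N).pow_const 2) (ha₀.mul hb₀) (ha₀.pow_const 2)
    (hbL.mul (p := 4) (q := 4) haL) hd₀L hn hd hac hbc hac hac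
    (by rwa [integral_centered_comp_sq hτ hF])
  simp only [Pi.mul_apply, integral_centered_comp_sq hτ hF,
    integral_centered_comp_sq hτ (hG _)] at key
  convert key using 1
  · ext N ω
    rcases eq_or_ne N 0 with rfl | hN
    -- For `N = 0` the factor `√0 = 0` annihilates both sides.
    · simp
    · rw [estimS_eq_centered hN (∫ y, G N y ∂lam)]
  -- With `a`, `b` the centered outputs, `a * b - S * a²` is `a * (b - S * a)`.
  · congr 3
    congr 1
    ext w
    ring

/-- Asymptotic normality of the symmetrized estimator, for a pair `(τ, τ')` of identically
distributed functions of the sample. -/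
theorem tendstoInDistribution_estimT (hW : ∀ i, MeasurePreserving (W i) μ ν)
    (hind : iIndepFun W μ) (hτ : MeasurePreserving τ ν lam) (hτ' : MeasurePreserving τ' ν lam)
    (hG : ∀ N, Measurable (G N)) (hF : Measurable F) (hFL : MemLp F 4 lam) {c : ℝ}
    (h : Tendsto (fun N => eLpNorm (fun y => G N y - (F y + c)) 4 lam) atTop (𝓝 0))
    (hGL : ∀ N ≠ 0, MemLp (G N) 2 lam) (hv : variance F lam ≠ 0) :
    TendstoInDistribution (fun (N : ℕ) ω => √N *
      (estimT N (fun i => G N (τ (W i ω))) (fun i => G N (τ' (W i ω))) -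
        (∫ w, (G N (τ w) - ∫ y, G N y ∂lam) * (G N (τ' w) - ∫ y, G N y ∂lam) ∂ν) /
          variance (G N) lam)) atTop (id : ℝ → ℝ) (fun _ => μ)
      (gaussianReal 0 (variance (fun w => (F (τ w) - ∫ y, F y ∂lam) * (F (τ' w) - ∫ y, F y ∂lam) -
          (∫ w, (F (τ w) - ∫ y, F y ∂lam) * (F (τ' w) - ∫ y, F y ∂lam) ∂ν) / variance F lam / 2 *
            ((F (τ w) - ∫ y, F y ∂lam) ^ 2 + (F (τ' w) - ∫ y, F y ∂lam) ^ 2)) ν /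
              variance F lam ^ 2).toNNReal) := by
  have h4 : (1 : ENNReal) ≤ 4 := by norm_num
  have hGi : ∀ᶠ N in atTop, Integrable (G N) lam :=
    (eventually_ne_atTop 0).mono fun N hN => (hGL N hN).integrable (by norm_num)
  have ha := tendsto_eLpNorm_centered_comp hτ hG hF hFL h
  have hb := tendsto_eLpNorm_centered_comp hτ' hG hF hFL h
  have haL := memLp_centered_comp hτ hFL
  have hbL := memLp_centered_comp hτ' hFL
  have ham : ∀ N, Measurable (fun w => G N (τ w) - ∫ y, G N y ∂lam) := fun N =>
    ((hG N).comp hτ.measurable).sub_const _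
  have hbm : ∀ N, Measurable (fun w => G N (τ' w) - ∫ y, G N y ∂lam) := fun N =>
    ((hG N).comp hτ'.measurable).sub_const _
  have ha₀ : Measurable (fun w => F (τ w) - ∫ y, F y ∂lam) :=
    (hF.comp hτ.measurable).sub_const _
  have hb₀ : Measurable (fun w => F (τ' w) - ∫ y, F y ∂lam) :=
    (hF.comp hτ'.measurable).sub_const _
  have hp := tendsto_eLpNorm_half_add_sub h4 ham hbm ha₀ hb₀ ha hb
  have hpL : MemLp (fun w => ((F (τ w) - ∫ y, F y ∂lam) + (F (τ' w) - ∫ y, F y ∂lam)) / 2) 4 ν := by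
    simp only [div_eq_mul_inv]
    exact (haL.add hbL).mul_const _
  have hpm : ∀ N, Measurable (fun w =>
      ((G N (τ w) - ∫ y, G N y ∂lam) + (G N (τ' w) - ∫ y, G N y ∂lam)) / 2) := fun N =>
    ((ham N).add (hbm N)).div_const 2
  have hpc := centeredL2Bounded_of_tendsto hpm hpL hp (by
    filter_upwards [hGi] with N hN
    have i1 : Integrable (fun w => G N (τ w) - ∫ y, G N y ∂lam) ν :=
      (hτ.integrable_comp_of_integrable hN).sub (integrable_const _)
    have i2 : Integrable (fun w => G N (τ' w) - ∫ y, G N y ∂lam) ν :=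
      (hτ'.integrable_comp_of_integrable hN).sub (integrable_const _)
    rw [integral_div, integral_add i1 i2,
      integral_centered_comp hτ (hG N) hN, integral_centered_comp hτ' (hG N) hN]
    simp)
  have hn := tendsto_eLpNorm_mul_sub_mul ham hbm haL hbL ha hb
  have hd1 := tendsto_eLpNorm_mul_sub_mul ham ham haL haL ha ha
  have hd2 := tendsto_eLpNorm_mul_sub_mul hbm hbm hbL hbL hb hb
  simp only [← sq] at hd1 hd2
  have hd := tendsto_eLpNorm_half_add_sub (by norm_num) (fun N => (ham N).pow_const 2)
    (fun N => (hbm N).pow_const 2) (ha₀.pow_const 2) (hb₀.pow_const 2) hd1 hd2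
  have hsqL : ∀ {g : 𝒲 → ℝ}, MemLp g 4 ν → MemLp (fun w => g w ^ 2) 2 ν := fun hg => by
    simp only [sq]
    exact hg.mul (p := 4) (q := 4) hg
  have hd₀L : MemLp (fun w => ((F (τ w) - ∫ y, F y ∂lam) ^ 2 +
      (F (τ' w) - ∫ y, F y ∂lam) ^ 2) / 2) 2 ν := by
    simp only [div_eq_mul_inv]
    exact ((hsqL haL).add (hsqL hbL)).mul_const _
  -- The symmetrized denominator has the variance as mean because `τ` and `τ'` have the same law.
  -- Splitting the integral of the sum uses square integrability, hence `hGL` for every `N ≠ 0`.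
  have hmean : ∀ {g : 𝒴 → ℝ}, Measurable g → MemLp g 2 lam →
      ∫ w, ((g (τ w) - ∫ y, g y ∂lam) ^ 2 + (g (τ' w) - ∫ y, g y ∂lam) ^ 2) / 2 ∂ν =
        variance g lam := fun {g} hgm hgL => by
    rw [integral_div, integral_add (memLp_centered_comp hτ hgL).integrable_sq
      (memLp_centered_comp hτ' hgL).integrable_sq, integral_centered_comp_sq hτ hgm,
      integral_centered_comp_sq hτ' hgm]
    ring
  have h24 : (2 : ENNReal) ≤ 4 := by exact_mod_cast (by norm_num : (2 : ℕ) ≤ 4)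
  have key := tendstoInDistribution_ratio hW hind (fun N => (ham N).mul (hbm N))
    (fun N => (((ham N).pow_const 2).add ((hbm N).pow_const 2)).div_const 2) (ha₀.mul hb₀)
    (((ha₀.pow_const 2).add (hb₀.pow_const 2)).div_const 2)
    (hbL.mul (p := 4) (q := 4) haL) hd₀L hn hd hpc hpc hpc hpc
    (by simpa only [Pi.add_apply, hmean hF (hFL.mono_exponent h24)] using hv)
  simp only [Pi.mul_apply, Pi.add_apply, hmean hF (hFL.mono_exponent h24)] at key
  convert key using 1
  · ext N ω
    rcases eq_or_ne N 0 with rfl | hN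
    · simp
    · rw [estimT_eq_centered hN (∫ y, G N y ∂lam), hmean (hG N) (hGL N hN)]
  · congr 3
    congr 1
    ext w
    ring

end PickFreeze

/-! ### Regrouping the inputs -/

section Input

variable {Ω 𝒳 𝒵 E : Type*} [MeasurableSpace Ω] [MeasurableSpace 𝒳] [MeasurableSpace 𝒵]
  [MeasurableSpace E] {P : Measure Ω} [IsProbabilityMeasure P] {X : Ω → 𝒳} {Z Z' : Ω → 𝒵}
  {ξ ξ' : Ω → E}

/-- Grouping the inputs as `(X, (Z, ξ), (Z', ξ'))`. -/
def groupInput (w : 𝒳 × 𝒵 × E × 𝒵 × E) : 𝒳 × (𝒵 × E) × (𝒵 × E) :=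
  (w.1, (w.2.1, w.2.2.1), w.2.2.2)

lemma measurable_groupInput : Measurable (groupInput : 𝒳 × 𝒵 × E × 𝒵 × E → _) := by
  unfold groupInput
  fun_prop

omit [IsProbabilityMeasure P] in
lemma IsPickFreezeInput.measurable (hin : IsPickFreezeInput P X Z ξ Z' ξ') :
    Measurable (fun ω => (X ω, Z ω, ξ ω, Z' ω, ξ' ω)) :=
  hin.measurable_X.prodMk (hin.measurable_Z.prodMk (hin.measurable_ξ.prodMk
    (hin.measurable_Z'.prodMk hin.measurable_ξ')))

/-- The noise joins `Z` in one block `R = (Z, ξ)`, so the exact model and the noisy metamodels are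
all functions of `(X, R)` and share one pick-freeze identity. -/
lemma IsPickFreezeInput.measurePreserving (hin : IsPickFreezeInput P X Z ξ Z' ξ') :
    MeasurePreserving (fun ω => (X ω, (Z ω, ξ ω), (Z' ω, ξ' ω))) P
      ((P.map X).prod (((P.map Z).prod (P.map ξ)).prod ((P.map Z).prod (P.map ξ)))) := by
  have := Measure.isProbabilityMeasure_map (μ := P) hin.measurable_X.aemeasurable
  have := Measure.isProbabilityMeasure_map (μ := P) hin.measurable_Z.aemeasurable
  have := Measure.isProbabilityMeasure_map (μ := P) hin.measurable_ξ.aemeasurable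
  have h1 : MeasurePreserving (fun ω => (X ω, Z ω, ξ ω, Z' ω, ξ' ω)) P _ :=
    ⟨hin.measurable, hin.map_eq⟩
  have h2 : MeasurePreserving (groupInput : 𝒳 × 𝒵 × E × 𝒵 × E → _)
      ((P.map X).prod ((P.map Z).prod ((P.map ξ).prod ((P.map Z).prod (P.map ξ)))))
      ((P.map X).prod (((P.map Z).prod (P.map ξ)).prod ((P.map Z).prod (P.map ξ)))) :=
    (MeasurePreserving.id (P.map X)).prod
      ((measurePreserving_prodAssoc (P.map Z) (P.map ξ) ((P.map Z).prod (P.map ξ))).symm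
        MeasurableEquiv.prodAssoc)
  exact h2.comp h1

end Input

end SobolPickFreeze

/-! ### Transfer to the laws of the inputs and conclusion -/

open SobolPickFreeze

theorem mainTheorem7
    {Ω₀ Ω 𝒳 𝒵 E : Type*} [MeasurableSpace Ω₀] [MeasurableSpace Ω]
    [MeasurableSpace 𝒳] [MeasurableSpace 𝒵] [MeasurableSpace E]
    -- the exact model: inputs `X`, `Z`, noise `ξ`, and independent copies `Z'`, `ξ'`
    (P : Measure Ω₀) [IsProbabilityMeasure P]
    (X : Ω₀ → 𝒳) (Z : Ω₀ → 𝒵) (ξ : Ω₀ → E) (Z' : Ω₀ → 𝒵) (ξ' : Ω₀ → E)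
    (hin : SobolPickFreeze.IsPickFreezeInput P X Z ξ Z' ξ')
    (f : 𝒳 → 𝒵 → ℝ) (hf : Measurable (fun p : 𝒳 × 𝒵 => f p.1 p.2))
    (Y YX : Ω₀ → ℝ) (hY : Y = fun ω => f (X ω) (Z ω)) (hYX : YX = fun ω => f (X ω) (Z' ω))
    (hY2 : MemLp Y 2 P) (hYvar : variance Y P ≠ 0)
    -- the metamodels `f + δ N`
    (δ : ℕ → 𝒳 → 𝒵 → E → ℝ)
    (hδ : ∀ N, Measurable (fun p : 𝒳 × 𝒵 × E => δ N p.1 p.2.1 p.2.2))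
    (ftil : ℕ → 𝒳 → 𝒵 → E → ℝ) (hftil : ftil = fun N x z e => f x z + δ N x z e)
    (Ytil : ℕ → Ω₀ → ℝ) (hYtil : Ytil = fun N ω => ftil N (X ω) (Z ω) (ξ ω))
    -- `δ N` converges in `L²` to a constant
    (c : ℝ)
    (hc : Tendsto (fun N => eLpNorm (fun ω => δ N (X ω) (Z ω) (ξ ω) - c) 2 P) atTop (𝓝 0))
    -- uniform bound on the moments of order `4 + s`
    (s C : ℝ) (hs : 0 < s) (hC : 0 < C)
    (hmom : ∀ N, 1 ≤ N → ∫⁻ ω, ENNReal.ofReal (|Ytil N ω| ^ (4 + s)) ∂P < ENNReal.ofReal C)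
    -- the i.i.d. sample
    (μ : Measure Ω) [IsProbabilityMeasure μ]
    (Xs : ℕ → Ω → 𝒳) (Zs : ℕ → Ω → 𝒵) (ξs : ℕ → Ω → E) (Zs' : ℕ → Ω → 𝒵) (ξs' : ℕ → Ω → E)
    (hsample : SobolPickFreeze.IsIIDSample μ
      (fun i ω => (Xs i ω, Zs i ω, ξs i ω, Zs' i ω, ξs' i ω))
      P (fun ω => (X ω, Z ω, ξ ω, Z' ω, ξ' ω))) :
    TendstoInDistribution
        (fun (N : ℕ) ω => Real.sqrt N *
          (SobolPickFreeze.estimS N (fun i => ftil N (Xs i ω) (Zs i ω) (ξs i ω))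
              (fun i => ftil N (Xs i ω) (Zs' i ω) (ξs' i ω)) -
            SobolPickFreeze.sobolIndex P X (Ytil N)))
        atTop (id : ℝ → ℝ) (fun _ => μ)
        (gaussianReal 0
          (SobolPickFreeze.sigmaSqS P Y YX (SobolPickFreeze.sobolIndex P X Y)).toNNReal) ∧
      TendstoInDistribution
        (fun (N : ℕ) ω => Real.sqrt N *
          (SobolPickFreeze.estimT N (fun i => ftil N (Xs i ω) (Zs i ω) (ξs i ω))
              (fun i => ftil N (Xs i ω) (Zs' i ω) (ξs' i ω)) -
            SobolPickFreeze.sobolIndex P X (Ytil N)))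
        atTop (id : ℝ → ℝ) (fun _ => μ)
        (gaussianReal 0
          (SobolPickFreeze.sigmaSqT P Y YX (SobolPickFreeze.sobolIndex P X Y)).toNNReal) := by

  have := Measure.isProbabilityMeasure_map (μ := P) hin.measurable_X.aemeasurable
  have := Measure.isProbabilityMeasure_map (μ := P) hin.measurable_Z.aemeasurable
  have := Measure.isProbabilityMeasure_map (μ := P) hin.measurable_ξ.aemeasurable
  set κ := P.map X with hκ
  set ρ := (P.map Z).prod (P.map ξ) with hρ
  have hV : MeasurePreserving (fun ω => (X ω, (Z ω, ξ ω), (Z' ω, ξ' ω))) P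
      (κ.prod (ρ.prod ρ)) := hin.measurePreserving
  have hτ : MeasurePreserving (fun z : 𝒳 × (𝒵 × E) × (𝒵 × E) => (z.1, z.2.1)) (κ.prod (ρ.prod ρ))
      (κ.prod ρ) := (MeasurePreserving.id κ).prod measurePreserving_fst
  have hτ' : MeasurePreserving (fun z : 𝒳 × (𝒵 × E) × (𝒵 × E) => (z.1, z.2.2)) (κ.prod (ρ.prod ρ))
      (κ.prod ρ) := (MeasurePreserving.id κ).prod measurePreserving_snd
  have hXR : MeasurePreserving (fun ω => (X ω, (Z ω, ξ ω))) P (κ.prod ρ) := hτ.comp hV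
  set G : ℕ → 𝒳 × (𝒵 × E) → ℝ := fun N y => ftil N y.1 y.2.1 y.2.2 with hGdef
  set F : 𝒳 × (𝒵 × E) → ℝ := fun y => f y.1 y.2.1 with hFdef
  have hFm : Measurable F :=
    hf.comp (measurable_fst.prodMk (measurable_fst.comp measurable_snd))
  have hGm : ∀ N, Measurable (G N) := fun N => by
    simp only [hGdef, hftil]
    exact hFm.add (hδ N)
  have hYG : ∀ N, Ytil N = fun ω => G N (X ω, (Z ω, ξ ω)) := fun N => by rw [hYtil]
  have hYF : Y = fun ω => F (X ω, (Z ω, ξ ω)) := hY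
  have hYXF : YX = fun ω => F (X ω, (Z' ω, ξ' ω)) := hYX
  have hq0 : ENNReal.ofReal (4 + s) ≠ 0 := by simpa using by positivity
  have hq4 : (2 : ENNReal) ≤ ENNReal.ofReal (4 + s) := by
    rw [show (2 : ENNReal) = ENNReal.ofReal 2 by simp]
    exact ENNReal.ofReal_le_ofReal (by linarith)
  have hGb : ∀ N ≠ 0, eLpNorm (G N) (ENNReal.ofReal (4 + s)) (κ.prod ρ) ≤
      ENNReal.ofReal C ^ (1 / (4 + s)) := fun N hN => by
    rw [← eLpNorm_comp_of_measurePreserving hXR (hGm N), ← hYG N,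
      eLpNorm_eq_lintegral_rpow_enorm_toReal hq0 (by simp),
      ENNReal.toReal_ofReal (by positivity)]
    gcongr
    refine le_trans (le_of_eq (lintegral_congr fun ω => ?_))
      (hmom N (Nat.one_le_iff_ne_zero.2 hN)).le
    rw [Real.enorm_eq_ofReal_abs, ENNReal.ofReal_rpow_of_nonneg (abs_nonneg _) (by positivity)]
  have hK : ENNReal.ofReal C ^ (1 / (4 + s)) ≠ ⊤ :=
    ENNReal.rpow_ne_top_of_nonneg (by positivity) (by simp)
  have hGL : ∀ N ≠ 0, MemLp (G N) 2 (κ.prod ρ) := fun N hN =>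
    MemLp.mono_exponent ⟨(hGm N).aestronglyMeasurable, (hGb N hN).trans_lt hK.lt_top⟩ hq4
  have h2 : Tendsto (fun N => eLpNorm (fun y => G N y - (F y + c)) 2 (κ.prod ρ)) atTop (𝓝 0) := by
    refine hc.congr fun N => ?_
    rw [← eLpNorm_comp_of_measurePreserving hXR
      (g := fun y => G N y - (F y + c)) ((hGm N).sub (hFm.add_const c))]
    congr 1
    ext ω
    simp only [hGdef, hFdef, hftil]
    ring
  -- The exact output is only assumed to be in `L²`; its fourth moment comes from the uniform bound
  -- on the metamodels.
  obtain ⟨hFc, h4⟩ := tendsto_eLpNorm_four hs hGm (hFm.add_const c) hK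
    ((eventually_ne_atTop 0).mono hGb) h2
  have hFL : MemLp F 4 (κ.prod ρ) := by
    convert hFc.sub (memLp_const c) using 1
    ext y
    simp
  have hFL2 : MemLp F 2 (κ.prod ρ) :=
    hFL.mono_exponent (by exact_mod_cast (by norm_num : (2 : ℕ) ≤ 4))
  have hvar : ∀ g : 𝒳 × (𝒵 × E) → ℝ, Measurable g →
      variance (fun ω => g (X ω, (Z ω, ξ ω))) P = variance g (κ.prod ρ) := fun g hg =>
    variance_comp_of_measurePreserving hXR hg
  have hv : variance F (κ.prod ρ) ≠ 0 := by rw [← hvar F hFm, ← hYF]; exact hYvar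
  have hEY : ∫ ω, Y ω ∂P = ∫ y, F y ∂(κ.prod ρ) := by
    rw [hYF, integral_comp_of_measurePreserving hXR hFm]
  have hsob : ∀ g : 𝒳 × (𝒵 × E) → ℝ, Measurable g → MemLp g 2 (κ.prod ρ) →
      sobolIndex P X (fun ω => g (X ω, (Z ω, ξ ω))) =
        (∫ z, (g (z.1, z.2.1) - ∫ y, g y ∂(κ.prod ρ)) * (g (z.1, z.2.2) - ∫ y, g y ∂(κ.prod ρ))
          ∂(κ.prod (ρ.prod ρ))) / variance g (κ.prod ρ) := fun g hg hgL => by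
    rw [sobolIndex, variance_condExp_eq_integral_mul hin.measurable_X hV hg hgL rfl, hvar g hg]
  have hW : ∀ i, MeasurePreserving
      (fun ω => (Xs i ω, (Zs i ω, ξs i ω), (Zs' i ω, ξs' i ω))) μ (κ.prod (ρ.prod ρ)) := fun i => by
    have h1 : MeasurePreserving (fun ω => (Xs i ω, Zs i ω, ξs i ω, Zs' i ω, ξs' i ω)) μ
        (P.map (fun ω => (X ω, Z ω, ξ ω, Z' ω, ξ' ω))) :=
      ⟨hsample.measurable i, (hsample.identDistrib i).map_eq⟩
    have h2 : MeasurePreserving (groupInput : 𝒳 × 𝒵 × E × 𝒵 × E → _)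
        (P.map (fun ω => (X ω, Z ω, ξ ω, Z' ω, ξ' ω))) (κ.prod (ρ.prod ρ)) :=
      ⟨measurable_groupInput, by
        rw [Measure.map_map measurable_groupInput hin.measurable]
        exact hV.map_eq⟩
    exact h2.comp h1
  have hind : iIndepFun (fun i ω => (Xs i ω, (Zs i ω, ξs i ω), (Zs' i ω, ξs' i ω))) μ :=
    hsample.indep.comp (fun _ => groupInput) fun _ => measurable_groupInput
  have hF1 : Measurable (fun z : 𝒳 × (𝒵 × E) × (𝒵 × E) =>
      F (z.1, z.2.1) - ∫ y, F y ∂(κ.prod ρ)) := (hFm.comp hτ.measurable).sub_const _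
  have hF2 : Measurable (fun z : 𝒳 × (𝒵 × E) × (𝒵 × E) =>
      F (z.1, z.2.2) - ∫ y, F y ∂(κ.prod ρ)) := (hFm.comp hτ'.measurable).sub_const _
  have hSF := hsob F hFm hFL2
  rw [← hYF] at hSF
  have hvarT : ∀ S : ℝ, variance (fun ω => (F (X ω, (Z ω, ξ ω)) - ∫ y, F y ∂(κ.prod ρ)) *
      (F (X ω, (Z' ω, ξ' ω)) - ∫ y, F y ∂(κ.prod ρ)) - S / 2 *
        ((F (X ω, (Z ω, ξ ω)) - ∫ y, F y ∂(κ.prod ρ)) ^ 2 +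
          (F (X ω, (Z' ω, ξ' ω)) - ∫ y, F y ∂(κ.prod ρ)) ^ 2)) P =
      variance (fun w : 𝒳 × (𝒵 × E) × (𝒵 × E) => (F (w.1, w.2.1) - ∫ y, F y ∂(κ.prod ρ)) *
        (F (w.1, w.2.2) - ∫ y, F y ∂(κ.prod ρ)) - S / 2 *
          ((F (w.1, w.2.1) - ∫ y, F y ∂(κ.prod ρ)) ^ 2 +
            (F (w.1, w.2.2) - ∫ y, F y ∂(κ.prod ρ)) ^ 2)) (κ.prod (ρ.prod ρ)) := fun S =>
    variance_comp_of_measurePreserving hV (g := fun w : 𝒳 × (𝒵 × E) × (𝒵 × E) =>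
      (F (w.1, w.2.1) - ∫ y, F y ∂(κ.prod ρ)) *
        (F (w.1, w.2.2) - ∫ y, F y ∂(κ.prod ρ)) - S / 2 *
          ((F (w.1, w.2.1) - ∫ y, F y ∂(κ.prod ρ)) ^ 2 +
            (F (w.1, w.2.2) - ∫ y, F y ∂(κ.prod ρ)) ^ 2))
      ((hF1.mul hF2).sub (((hF1.pow_const 2).add (hF2.pow_const 2)).const_mul (S / 2)))
  constructor
  · convert tendstoInDistribution_estimS hW hind hτ hτ' hGm hFm hFL h4 hv using 1
    · ext N ω
      -- The moment bound starts at `N = 1`, so `Ytil 0` need not be square integrable; the factor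
      -- `√0` makes that case trivial.
      rcases eq_or_ne N 0 with rfl | hN
      · simp
      · rw [hYG N, hsob (G N) (hGm N) (hGL N hN)]
    · rw [← hSF, sigmaSqS, hEY]
      congr 3
      · generalize sobolIndex P X Y = S
        rw [hYF, hYXF]
        exact variance_comp_of_measurePreserving hV (hF1.mul (hF2.sub (hF1.const_mul S)))
      · rw [hYF, hvar F hFm]
  · convert tendstoInDistribution_estimT hW hind hτ hτ' hGm hFm hFL h4 hGL hv using 1
    · ext N ω
      rcases eq_or_ne N 0 with rfl | hN
      · simp
      · rw [hYG N, hsob (G N) (hGm N) (hGL N hN)]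
    · rw [← hSF, sigmaSqT, hEY]
      congr 3
      · generalize sobolIndex P X Y = S
        rw [hYF, hYXF]
        exact hvarT S
      · rw [hYF, hvar F hFm]
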